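/- Let $J\ge 1$, $T>0$, $K>0$, and for $j\in\{1,\dots,J\}$ let $\lambda^j>0$, $\alpha^j\ge 0$, and let $f^j$ be the probability density of a positive random variable (the price to beat at source $j$) with $f^j(p)>0$ for all $p>0$ and $\lim_{p\to+\infty}p^3f^j(p)=0$. For $b\in[0,+\infty]$ put $F^j(b)=\int_0^b f^j(p)\,dp$ and $G^j(b)=\int_0^b p f^j(p)\,dp$. For $t\in[0,T]$ and $S\in\mathbb R$, the fluid problem is $$\tilde v(t,S)=\inf_{b}\Big(-\sum_{j=1}^J\lambda^j\alpha^j\int_t^T F^j(b^j_s)\,ds+K\min(S_T,0)^2\Big),\qquad dS_s=-\sum_{j=1}^J\lambda^jG^j(b^j_s)\,ds,\quad S_t=S,$$ where the infimum is over all (deterministic) measurable $b=(b^1,\dots,b^J):[t,T]\to[0,+\infty]^J$. Let $$H^j(x)=\lambda^j\sup_{b\ge 0}\int_0^b f^j(p)(\alpha^j+xp)\,dp,\qquad H=H^1+\dots+H^J .$$ (1) For all $t\in[0,T]$, $S\in\mathbb R$, $$\tilde v(t,S)=\sup_{x\le 0}\Big(Sx-(T-t)H(x)-\frac{x^2}{4K}\Big).$$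 (2) $\tilde v$ is the unique weak semi-concave solution on $[0,T]\times\mathbb R$ of $$-\partial_t v(t,S)-\sum_{j=1}^J\lambda^j\inf_{b\ge 0}\Big(-\int_0^b f^j(p)\big(\alpha^j+p\,\partial_Sv(t,S)\big)dp\Big)=0,\qquad v(T,S)=K\min(S,0)^2 .$$ Here a weak semi-concave solution is a function $v$ on $[0,T]\times\mathbb R$ that is Lipschitz on bounded sets, has this terminal value, is differentiable and satisfies the equation at almost every $(t,S)\in(0,T)\times\mathbb R$, and for which there is $C\ge 0$ with $v(t,S+z)-2v(t,S)+v(t,S-z)\le C\big(1+\frac1{T-t}\big)z^2$ for all $t\in[0,T)$ and $S,z\in\mathbb R$. (3) If $S\ge\sum_{j}\lambda^j(T-t)\int_0^\infty pf^j(p)\,dp$, then bidding $+\infty$ for all sources on $[t,T]$ is optimal from $(t,S)$. If $x^*<0$ satisfies $S=(T-t)H'(x^*)+\frac{x^*}{2K}$, then bidding $-\alpha^j/x^*$ for each source $j$ on $[t,T]$ is optimal from $(t,S)$. If moreover all $\alpha^j$ are positive, then $H$ is differentiable and the optimal control function $(t,S)\mapsto\tilde b^*(t,S)$ is given by: - if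 $S\ge\sum_{j}\lambda^j(T-t)\int_0^\infty pf^j(p)\,dp$, then $\tilde b^{j*}(t,S)=+\infty$ for all $j$; - if $S<\sum_{j}\lambda^j(T-t)\int_0^\infty pf^j(p)\,dp$, then $\tilde b^{j*}(t,S)=-\alpha^j/x^*$ for all $j$, where $x^*$ is the unique real solution of $S=(T-t)H'(x^*)+\frac{x^*}{2K}$, and $x^*<0$. That is, from every $(t,S)\in[0,T]\times\mathbb R$ there is a control $b$ with $b^j_s=\tilde b^{j*}(s,S_s)$ for all $j$ and almost every $s\in[t,T]$, where $(S_s)$ is the trajectory generated by $b$, and a control is optimal from $(t,S)$ if and only if it has this property. -/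

import Mathlib

open MeasureTheory Set Filter Topology
open scoped NNReal ENNReal

noncomputable section

/-- `f` is the probability density of a positive random variable (the price to beat), everywhere
positive on `(0, ∞)` and with `p ^ 3 * f p → 0` at infinity. Only the values of `f` on `(0, ∞)`
matter. -/
structure IsPriceDensity (f : ℝ → ℝ) : Prop where
  measurable : Measurable f
  pos : ∀ p : ℝ, 0 < p → 0 < f p
  integrableOn : IntegrableOn f (Ioi 0)
  integral_eq_one : ∫ p in Ioi (0 : ℝ), f p = 1
  tendsto_cube : Tendsto (fun p : ℝ => p ^ 3 * f p) atTop (𝓝 0)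

/-- The prices in `(0, b]`, for a bid `b ∈ [0, +∞]`. -/
def pricesUpTo (b : ℝ≥0∞) : Set ℝ := {p : ℝ | 0 < p ∧ ENNReal.ofReal p ≤ b}

/-- `F(b) = ∫_0^b f(p) dp`, the cumulative distribution function on `[0, +∞]`. -/
def priceCDF (f : ℝ → ℝ) (b : ℝ≥0∞) : ℝ := ∫ p in pricesUpTo b, f p

/-- `G(b) = ∫_0^b p f(p) dp` on `[0, +∞]`. -/
def priceSpend (f : ℝ → ℝ) (b : ℝ≥0∞) : ℝ := ∫ p in pricesUpTo b, p * f p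

/-- `E[p] = ∫_0^∞ p f(p) dp`. -/
def meanPrice (f : ℝ → ℝ) : ℝ := ∫ p in Ioi (0 : ℝ), p * f p

/-- `H^j(x) = λ^j sup_{b ≥ 0} ∫_0^b f^j(p) (α^j + x p) dp` for one source. -/
def sourceHamiltonian (lam α : ℝ) (f : ℝ → ℝ) (x : ℝ) : ℝ :=
  lam * ⨆ b : ℝ≥0, ∫ p in (0 : ℝ)..b, f p * (α + x * p)

/-- `H = H^1 + ... + H^J`. -/
def hamiltonian {J : ℕ} (lam α : Fin J → ℝ) (f : Fin J → ℝ → ℝ) (x : ℝ) : ℝ :=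
  ∑ j, sourceHamiltonian (lam j) (α j) (f j) x

/-- A deterministic control on `[t, T]`: one Lebesgue measurable bid function with values in
`[0, +∞]` for each source. -/
def IsControl {J : ℕ} (t T : ℝ) (b : Fin J → ℝ → ℝ≥0∞) : Prop :=
  ∀ j, AEMeasurable (b j) (volume.restrict (Icc t T))

/-- The remaining cash at time `s`: the solution of `dS_s = - ∑ λ^j G^j(b^j_s) ds`, `S_t = S`. -/
def fluidCash {J : ℕ} (lam : Fin J → ℝ) (f : Fin J → ℝ → ℝ) (t S : ℝ)
    (b : Fin J → ℝ → ℝ≥0∞) (s : ℝ) : ℝ :=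
  S - ∫ r in t..s, ∑ j, lam j * priceSpend (f j) (b j r)

/-- The objective `- ∑ λ^j α^j ∫_t^T F^j(b^j_s) ds + K min(S_T, 0)^2`. -/
def fluidCost {J : ℕ} (lam α : Fin J → ℝ) (f : Fin J → ℝ → ℝ) (K T t S : ℝ)
    (b : Fin J → ℝ → ℝ≥0∞) : ℝ :=
  -(∑ j, lam j * α j * ∫ s in t..T, priceCDF (f j) (b j s)) +
    K * min (fluidCash lam f t S b T) 0 ^ 2

/-- The value function of the fluid problem. -/
def fluidValue {J : ℕ} (lam α : Fin J → ℝ) (f : Fin J → ℝ → ℝ) (K T t S : ℝ) : ℝ :=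
  sInf {c : ℝ | ∃ b : Fin J → ℝ → ℝ≥0∞, IsControl t T b ∧ c = fluidCost lam α f K T t S b}

/-- The control `b` is optimal for the fluid problem started at time `t` with cash `S`. -/
def IsOptimalControl {J : ℕ} (lam α : Fin J → ℝ) (f : Fin J → ℝ → ℝ) (K T t S : ℝ)
    (b : Fin J → ℝ → ℝ≥0∞) : Prop :=
  IsControl t T b ∧ ∀ b' : Fin J → ℝ → ℝ≥0∞, IsControl t T b' →
    fluidCost lam α f K T t S b ≤ fluidCost lam α f K T t S b'

/-- The control `b` is, at almost every time, the feedback `β` evaluated along the trajectory that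
`b` itself generates from `(t, S)`. -/
def FollowsFeedback {J : ℕ} (lam : Fin J → ℝ) (f : Fin J → ℝ → ℝ) (T t S : ℝ)
    (β : Fin J → ℝ → ℝ → ℝ≥0∞) (b : Fin J → ℝ → ℝ≥0∞) : Prop :=
  ∀ j, ∀ᵐ s ∂(volume.restrict (Icc t T)), b j s = β j s (fluidCash lam f t S b s)

/-- `β` is the optimal control function: from every initial condition the closed-loop equation has
a solution, and the optimal controls are exactly the closed-loop ones. -/
def IsOptimalFeedback {J : ℕ} (lam α : Fin J → ℝ) (f : Fin J → ℝ → ℝ) (K T : ℝ)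
    (β : Fin J → ℝ → ℝ → ℝ≥0∞) : Prop :=
  ∀ t ∈ Icc 0 T, ∀ S : ℝ,
    (∃ b : Fin J → ℝ → ℝ≥0∞, IsControl t T b ∧ FollowsFeedback lam f T t S β b) ∧
    ∀ b : Fin J → ℝ → ℝ≥0∞, IsControl t T b →
      (IsOptimalControl lam α f K T t S b ↔ FollowsFeedback lam f T t S β b)

/-- The left-hand side of the Hamilton-Jacobi equation
`-∂_t v - ∑ λ^j inf_{b ≥ 0} (- ∫_0^b f^j(p) (α^j + p ∂_S v) dp) = 0`,
as a function of the two partial derivatives. -/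
def hjOperator {J : ℕ} (lam α : Fin J → ℝ) (f : Fin J → ℝ → ℝ) (vt vS : ℝ) : ℝ :=
  -vt - ∑ j, lam j * ⨅ b : ℝ≥0, -∫ p in (0 : ℝ)..b, f j p * (α j + p * vS)

/-- Weak semi-concave solutions of the terminal value problem on `[0, T] × ℝ`: locally Lipschitz
functions with the terminal value `K min(S, 0)^2`, which are differentiable and satisfy the equation
almost everywhere, and which are semi-concave in `S`, with a constant that may blow up like
`1 / (T - t)` at the terminal time. -/
structure IsWeakSemiconcaveSolution {J : ℕ} (lam α : Fin J → ℝ) (f : Fin J → ℝ → ℝ) (K T : ℝ)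
    (v : ℝ → ℝ → ℝ) : Prop where
  lipschitz : ∀ R : ℝ, ∃ L : ℝ≥0,
    LipschitzOnWith L (Function.uncurry v) (Icc 0 T ×ˢ Icc (-R) R)
  terminal : ∀ S : ℝ, v T S = K * min S 0 ^ 2
  equation : ∀ᵐ q : ℝ × ℝ, q.1 ∈ Ioo 0 T → ∃ vt vS : ℝ,
    HasFDerivAt (Function.uncurry v)
      (vt • ContinuousLinearMap.fst ℝ ℝ ℝ + vS • ContinuousLinearMap.snd ℝ ℝ ℝ) q ∧
    hjOperator lam α f vt vS = 0
  semiconcave : ∃ C : ℝ, 0 ≤ C ∧ ∀ t ∈ Ico 0 T, ∀ S z : ℝ,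
    v t (S + z) - 2 * v t S + v t (S - z) ≤ C * (1 + 1 / (T - t)) * z ^ 2

end

/-!
The value function is computed by convex duality. For a fixed `x ≤ 0`, completing the square in the
terminal penalty and maximizing `α F(b) + x G(b)` pointwise shows that every control costs at least
`S x - (T - t) H(x) - x² / (4K)`, with an explicit excess made of two nonnegative gaps
(`IsSourceFamily.fluidCost_eq`). The supremum of this strongly concave function of `x` is attained
at a point, the costate (`IsCostate`, `IsSourceFamily.exists_isCostate`), whose first-order
conditions say exactly that both gaps vanish when every source bids the maximizer `optimalBid` for
this `x` at all times. This gives the duality formula and the optimality of constant bids.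

The costate is a Lipschitz function of `(t, S)` (`IsSourceFamily.abs_costate_sub_le`), and it is the
`S`-derivative of the value function, while `H` of it is the `t`-derivative. Hence the value
function is `C^1` with second differences at most `4K z²`, and it solves the equation everywhere.

For uniqueness, let `w` be a weak semi-concave solution. It lies below the value function because
the convexity of `H` bounds its derivative along the line on which the optimal constant bids move
the cash; by Fubini almost every parallel line meets the exceptional null set in a null set
(`sub_le_of_ae_directional_le`). It lies above, because it lies above each of the affine solutions
`S x - (T - t) H(x) - x² / (4K)`: where a smooth function touches `w` from below, semi-concavity
makes the nearby gradients of `w` close to that of the test function, so that `w` is a viscosity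
supersolution (`IsSourceFamily.le_hamiltonian_of_touching`), and comparison with an affine solution
is then a penalization argument in the cone of propagation of slope `maxSpend`. Only the
Lipschitz continuity of `H` enters this half, so `H` may have a kink at `0`, as it does when some
weight vanishes.

For positive weights the maximizing bid is unique since the densities are positive, so optimal
controls are almost everywhere the constant bids of the costate, and these follow the feedback as
the costate is constant along the trajectory. Conversely, the spending rate of the feedback is
nondecreasing in the cash, so the closed-loop equation has only one trajectory
(`IsSourceFamily.eq_optimalBid_of_followsFeedback`).
-/

noncomputable section

/-! ### A single source -/

/-- `∫_0^∞ f(p) (α + x p)^+ dp`, the largest value of `α F(b) + x G(b)` over all bids `b`. -/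
def sourceGain (α : ℝ) (f : ℝ → ℝ) (x : ℝ) : ℝ := ∫ p in Ioi (0 : ℝ), f p * max (α + x * p) 0

/-- `∫ p f(p) dp` over the prices `p > 0` with `α + x p > 0`: the spending rate of the bid that
maximizes `α F(b) + x G(b)`, and a subgradient of `sourceGain α f` at `x`. -/
def sourceSpend (α : ℝ) (f : ℝ → ℝ) (x : ℝ) : ℝ :=
  ∫ p in Ioi (0 : ℝ), {p : ℝ | 0 < α + x * p}.indicator (fun p => p * f p) p

/-- For `x ≤ 0`, a bid that maximizes `α F(b) + x G(b)`. At `x = 0` the infinite bid is chosen,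
except for a source of weight `α = 0`, where the bid `0` is the limit of the maximizers as `x`
increases to `0`. -/
def optimalBid (α x : ℝ) : ℝ≥0∞ :=
  if x < 0 then ENNReal.ofReal (-α / x) else if α = 0 then 0 else ⊤

theorem measurableSet_pricesUpTo (b : ℝ≥0∞) : MeasurableSet (pricesUpTo b) :=
  measurableSet_Ioi.inter (measurableSet_le ENNReal.measurable_ofReal measurable_const)

theorem pricesUpTo_subset_Ioi (b : ℝ≥0∞) : pricesUpTo b ⊆ Ioi 0 := fun _ hp => hp.1

theorem pricesUpTo_top : pricesUpTo ⊤ = Ioi 0 := by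
  ext p; simp [pricesUpTo]

theorem pricesUpTo_mono {b c : ℝ≥0∞} (h : b ≤ c) : pricesUpTo b ⊆ pricesUpTo c :=
  fun _ hp => ⟨hp.1, hp.2.trans h⟩

theorem pricesUpTo_coe (b : ℝ≥0) : pricesUpTo b = Ioc 0 (b : ℝ) := by
  ext p
  simp only [pricesUpTo, mem_ofPred_eq, mem_Ioc]
  refine and_congr_right fun _ => ?_
  rw [ENNReal.ofReal_le_iff_le_toReal ENNReal.coe_ne_top, ENNReal.coe_toReal]

/-- The only non-trivial case is the boundary price `p = -α / x`, a null set. -/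
theorem pricesUpTo_optimalBid_ae_eq {α x : ℝ} (hα : 0 ≤ α) (hx : x ≤ 0) :
    pricesUpTo (optimalBid α x) =ᵐ[volume] (Ioi 0 ∩ {p : ℝ | 0 < α + x * p} : Set ℝ) := by
  rcases hx.lt_or_eq with hx | rfl
  · have hne : ∀ᵐ p : ℝ, p ≠ -α / x := by
      simp [ae_iff, measure_singleton]
    filter_upwards [hne] with p hp
    apply propext
    show p ∈ pricesUpTo _ ↔ p ∈ Ioi 0 ∩ _
    simp only [pricesUpTo, optimalBid, if_pos hx, mem_ofPred_eq, mem_inter_iff, mem_Ioi]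
    refine and_congr_right fun hp0 => ?_
    have h0 : 0 ≤ -α / x := div_nonneg_of_nonpos (by linarith) hx.le
    rw [ENNReal.ofReal_le_ofReal_iff h0]
    rw [show p ≤ -α / x ↔ p < -α / x from ⟨fun h => lt_of_le_of_ne h hp, le_of_lt⟩,
      lt_div_iff_of_neg hx]
    constructor <;> intro h <;> linarith
  · rcases hα.lt_or_eq with hα | rfl
    · rw [optimalBid, if_neg (lt_irrefl _), if_neg hα.ne', pricesUpTo_top]
      refine (ae_eq_refl _).trans (Eq.eventuallyEq ?_)
      ext p
      simp [hα]
    · have : pricesUpTo 0 = ∅ := by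
        ext p; simp [pricesUpTo]
      simp [optimalBid, this]

theorem measurableSet_linear_pos (α x : ℝ) : MeasurableSet {p : ℝ | 0 < α + x * p} :=
  measurableSet_lt measurable_const (by fun_prop)

theorem priceSpend_top (f : ℝ → ℝ) : priceSpend f ⊤ = meanPrice f := by
  rw [priceSpend, pricesUpTo_top, meanPrice]

theorem priceSpend_optimalBid (f : ℝ → ℝ) {α x : ℝ} (hα : 0 ≤ α) (hx : x ≤ 0) :
    priceSpend f (optimalBid α x) = sourceSpend α f x := by
  rw [priceSpend, sourceSpend, setIntegral_indicator (measurableSet_linear_pos α x)]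
  exact setIntegral_congr_set (pricesUpTo_optimalBid_ae_eq hα hx)

theorem sourceSpend_eq_meanPrice (f : ℝ → ℝ) {α : ℝ} (hα : 0 < α) {x : ℝ} (hx : 0 ≤ x) :
    sourceSpend α f x = meanPrice f := by
  refine setIntegral_congr_fun measurableSet_Ioi fun p hp => ?_
  have hp : 0 < p := hp
  exact indicator_of_mem
    (show p ∈ {p : ℝ | 0 < α + x * p} from add_pos_of_pos_of_nonneg hα (by positivity))
    (fun p => p * f p)

namespace IsPriceDensity

variable {f : ℝ → ℝ} (hf : IsPriceDensity f)
include hf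

/-- The decay of `p ^ 3 * f p` bounds `p * f p` by `p ^ (-2)` at infinity. -/
theorem integrableOn_mul : IntegrableOn (fun p => p * f p) (Ioi 0) := by
  have hev : ∀ᶠ p : ℝ in atTop, p ^ 3 * f p < 1 :=
    hf.tendsto_cube.eventually_lt_const one_pos
  obtain ⟨M, hM⟩ := eventually_atTop.1 (hev.and (eventually_gt_atTop 0))
  have hM0 : 0 < M := (hM M le_rfl).2
  rw [← Ioc_union_Ioi_eq_Ioi hM0.le]
  refine IntegrableOn.union ?_ ?_
  · refine Integrable.mono' ((hf.integrableOn.mono_set Ioc_subset_Ioi_self).const_mul M)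
      (measurable_id.mul hf.measurable).aestronglyMeasurable ?_
    filter_upwards [ae_restrict_mem measurableSet_Ioc] with p hp
    rw [Real.norm_of_nonneg (mul_nonneg hp.1.le (hf.pos p hp.1).le)]
    exact mul_le_mul_of_nonneg_right hp.2 (hf.pos p hp.1).le
  · refine Integrable.mono' (integrableOn_Ioi_rpow_of_lt (a := -2) (by norm_num) hM0)
      (measurable_id.mul hf.measurable).aestronglyMeasurable ?_
    filter_upwards [ae_restrict_mem measurableSet_Ioi] with p hp
    have hp : M < p := hp
    have hp0 : 0 < p := hM0.trans hp
    have h1 := (hM p hp.le).1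
    rw [Real.norm_of_nonneg (mul_nonneg hp0.le (hf.pos p hp0).le),
      Real.rpow_neg hp0.le, ← one_div, le_div_iff₀ (by positivity)]
    norm_num
    nlinarith

theorem integrableOn_linear (α x : ℝ) : IntegrableOn (fun p => f p * (α + x * p)) (Ioi 0) := by
  have := (hf.integrableOn.const_mul α).add (hf.integrableOn_mul.const_mul x)
  refine this.congr (ae_of_all _ fun p => ?_)
  simp only [Pi.add_apply]
  ring

theorem integrableOn_posPart (α x : ℝ) :
    IntegrableOn (fun p => f p * max (α + x * p) 0) (Ioi 0) := by
  refine Integrable.mono (hf.integrableOn_linear α x) (hf.measurable.mul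
    (g := fun p => max (α + x * p) 0) (by fun_prop)).aestronglyMeasurable ?_
  filter_upwards with p
  rw [norm_mul, norm_mul]
  refine mul_le_mul_of_nonneg_left ?_ (norm_nonneg _)
  rw [Real.norm_eq_abs, Real.norm_eq_abs, abs_of_nonneg (le_max_right _ _)]
  exact max_le (le_abs_self _) (abs_nonneg _)

theorem integrableOn_indicator (α x : ℝ) :
    IntegrableOn ({p : ℝ | 0 < α + x * p}.indicator (fun p => p * f p)) (Ioi 0) :=
  hf.integrableOn_mul.indicator (measurableSet_linear_pos α x)

theorem linear_combination_eq (α x : ℝ) (b : ℝ≥0∞) :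
    α * priceCDF f b + x * priceSpend f b = ∫ p in pricesUpTo b, f p * (α + x * p) := by
  rw [priceCDF, priceSpend, ← integral_const_mul, ← integral_const_mul, ← integral_add]
  · refine integral_congr_ae (ae_of_all _ fun p => ?_)
    simp only
    ring
  · exact (hf.integrableOn.mono_set (pricesUpTo_subset_Ioi b)).const_mul α
  · exact (hf.integrableOn_mul.mono_set (pricesUpTo_subset_Ioi b)).const_mul x

theorem linear_combination_eq_Ioi (α x : ℝ) (b : ℝ≥0∞) :
    α * priceCDF f b + x * priceSpend f b =
      ∫ p in Ioi 0, (pricesUpTo b).indicator (fun p => f p * (α + x * p)) p := by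
  rw [hf.linear_combination_eq, setIntegral_indicator (measurableSet_pricesUpTo b),
    inter_eq_right.2 (pricesUpTo_subset_Ioi b)]

theorem indicator_le_posPart (α x : ℝ) (b : ℝ≥0∞) {p : ℝ} (hp : 0 < p) :
    (pricesUpTo b).indicator (fun p => f p * (α + x * p)) p ≤ f p * max (α + x * p) 0 := by
  have h := (hf.pos p hp).le
  refine indicator_apply_le' (fun _ => ?_) (fun _ => mul_nonneg h (le_max_right _ _))
  exact mul_le_mul_of_nonneg_left (le_max_left _ _) h

theorem linear_combination_le (α x : ℝ) (b : ℝ≥0∞) :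
    α * priceCDF f b + x * priceSpend f b ≤ sourceGain α f x := by
  rw [hf.linear_combination_eq_Ioi]
  refine setIntegral_mono_on ((hf.integrableOn_linear α x).indicator (measurableSet_pricesUpTo b))
    (hf.integrableOn_posPart α x) measurableSet_Ioi fun p hp => ?_
  exact hf.indicator_le_posPart α x b hp

theorem linear_combination_optimalBid {α x : ℝ} (hα : 0 ≤ α) (hx : x ≤ 0) :
    α * priceCDF f (optimalBid α x) + x * priceSpend f (optimalBid α x) = sourceGain α f x := by
  rw [hf.linear_combination_eq, setIntegral_congr_set (pricesUpTo_optimalBid_ae_eq hα hx),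
    ← setIntegral_indicator (measurableSet_linear_pos α x), sourceGain]
  refine integral_congr_ae (ae_of_all _ fun p => ?_)
  by_cases h : 0 < α + x * p
  · simp [indicator, h, max_eq_left h.le]
  · simp [indicator, h, max_eq_right (not_lt.1 h)]

/-- Since `f` is positive, a bid other than the optimal one loses a set of prices of positive
measure on which the integrand is strictly positive, or gains one on which it is strictly
negative. -/
theorem eq_optimalBid {α x : ℝ} (hα : 0 < α) (hx : x ≤ 0) {b : ℝ≥0∞}
    (h : α * priceCDF f b + x * priceSpend f b = sourceGain α f x) : b = optimalBid α x := by
  have hsign : ∀ p : ℝ, 0 < p → (ENNReal.ofReal p < optimalBid α x → 0 < α + x * p) ∧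
      (optimalBid α x < ENNReal.ofReal p → α + x * p < 0) := by
    intro p hp
    rcases hx.lt_or_eq with hx | rfl
    · simp only [optimalBid, if_pos hx]
      constructor
      · intro h
        have := (ENNReal.ofReal_lt_ofReal_iff_of_nonneg hp.le).1 h
        rw [lt_div_iff_of_neg hx] at this
        linarith
      · intro h
        have := (ENNReal.ofReal_lt_ofReal_iff hp).1 h
        rw [div_lt_iff_of_neg hx] at this
        linarith
    · simp [optimalBid, hα.ne', hα]
  have hzero : ∀ᵐ p : ℝ, 0 < p →
      f p * max (α + x * p) 0 - (pricesUpTo b).indicator (fun p => f p * (α + x * p)) p = 0 := by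
    rw [hf.linear_combination_eq_Ioi, eq_comm, ← sub_eq_zero, sourceGain, ← integral_sub
      (hf.integrableOn_posPart α x)
      ((hf.integrableOn_linear α x).indicator (measurableSet_pricesUpTo b)),
      setIntegral_eq_zero_iff_of_nonneg_ae] at h
    · exact (ae_restrict_iff' measurableSet_Ioi).1 h
    · filter_upwards [ae_restrict_mem measurableSet_Ioi] with p hp
      exact sub_nonneg.2 (hf.indicator_le_posPart α x b hp)
    · exact (hf.integrableOn_posPart α x).sub
        ((hf.integrableOn_linear α x).indicator (measurableSet_pricesUpTo b))
  have hnull : ∀ c d : ℝ≥0∞, (∀ p : ℝ, 0 < p → c < ENNReal.ofReal p → ENNReal.ofReal p < d →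
      f p * max (α + x * p) 0 - (pricesUpTo b).indicator (fun p => f p * (α + x * p)) p ≠ 0) →
      d ≤ c := by
    intro c d hcd
    by_contra hlt
    obtain ⟨q, hq1, hq2⟩ := ENNReal.lt_iff_exists_nnreal_btwn.1 (not_le.1 hlt)
    have hopen : IsOpen {p : ℝ | c < ENNReal.ofReal p ∧ ENNReal.ofReal p < d} :=
      (isOpen_lt continuous_const ENNReal.continuous_ofReal).inter
        (isOpen_lt ENNReal.continuous_ofReal continuous_const)
    have hpos := hopen.measure_pos volume ⟨q, by simpa using hq1, by simpa using hq2⟩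
    refine hpos.ne' ?_
    refine measure_mono_null (fun p hp => ?_) (ae_iff.1 hzero)
    have hp0 : 0 < p := ENNReal.ofReal_pos.1 (bot_le.trans_lt hp.1)
    simp only [mem_ofPred_eq, Classical.not_imp]
    exact ⟨hp0, hcd p hp0 hp.1 hp.2⟩
  apply le_antisymm
  · refine hnull _ _ fun p hp h1 h2 => ?_
    have hneg := (hsign p hp).2 h1
    have hmem : p ∈ pricesUpTo b := ⟨hp, h2.le⟩
    rw [indicator_of_mem hmem, max_eq_right hneg.le]
    have := mul_neg_of_pos_of_neg (hf.pos p hp) hneg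
    intro h0
    linarith
  · refine hnull _ _ fun p hp h1 h2 => ?_
    have hpos := (hsign p hp).1 h2
    have hmem : p ∉ pricesUpTo b := fun hm => absurd hm.2 (not_le.2 h1)
    rw [indicator_of_notMem hmem, max_eq_left hpos.le, sub_zero]
    exact (mul_pos (hf.pos p hp) hpos).ne'

theorem monotone_priceCDF : Monotone (priceCDF f) := by
  intro b c hbc
  refine setIntegral_mono_set (hf.integrableOn.mono_set (pricesUpTo_subset_Ioi c)) ?_
    (pricesUpTo_mono hbc).eventuallyLE
  filter_upwards [ae_restrict_mem (measurableSet_pricesUpTo c)] with p hp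
  exact (hf.pos p hp.1).le

theorem monotone_priceSpend : Monotone (priceSpend f) := by
  intro b c hbc
  refine setIntegral_mono_set (hf.integrableOn_mul.mono_set (pricesUpTo_subset_Ioi c)) ?_
    (pricesUpTo_mono hbc).eventuallyLE
  filter_upwards [ae_restrict_mem (measurableSet_pricesUpTo c)] with p hp
  exact mul_nonneg hp.1.le (hf.pos p hp.1).le

theorem priceCDF_nonneg (b : ℝ≥0∞) : 0 ≤ priceCDF f b :=
  setIntegral_nonneg (measurableSet_pricesUpTo b) fun p hp => (hf.pos p hp.1).le

theorem priceSpend_nonneg (b : ℝ≥0∞) : 0 ≤ priceSpend f b :=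
  setIntegral_nonneg (measurableSet_pricesUpTo b) fun p hp =>
    mul_nonneg hp.1.le (hf.pos p hp.1).le

theorem priceCDF_top : priceCDF f ⊤ = 1 := by
  rw [priceCDF, pricesUpTo_top, hf.integral_eq_one]

theorem priceCDF_le_one (b : ℝ≥0∞) : priceCDF f b ≤ 1 :=
  hf.priceCDF_top ▸ hf.monotone_priceCDF le_top

theorem priceSpend_le (b : ℝ≥0∞) : priceSpend f b ≤ meanPrice f :=
  priceSpend_top f ▸ hf.monotone_priceSpend le_top

theorem sourceSpend_nonneg (α x : ℝ) : 0 ≤ sourceSpend α f x := by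
  rw [sourceSpend]
  exact setIntegral_nonneg measurableSet_Ioi fun p hp =>
    indicator_apply_nonneg fun _ => mul_nonneg (le_of_lt hp) (hf.pos p hp).le

theorem sourceSpend_le (α x : ℝ) : sourceSpend α f x ≤ meanPrice f := by
  refine setIntegral_mono_on (hf.integrableOn_indicator α x) hf.integrableOn_mul measurableSet_Ioi
    fun p hp => ?_
  exact indicator_apply_le' (fun _ => le_rfl) (fun _ => mul_nonneg (le_of_lt hp) (hf.pos p hp).le)

/-- The subgradient inequality, integrated from that of `y ↦ (α + y p)^+` at each price. -/
theorem sourceSpend_mul_sub_le (α x y : ℝ) :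
    sourceSpend α f x * (y - x) ≤ sourceGain α f y - sourceGain α f x := by
  rw [sourceSpend, sourceGain, sourceGain, ← integral_mul_const,
    ← integral_sub (hf.integrableOn_posPart α y) (hf.integrableOn_posPart α x)]
  refine setIntegral_mono_on ((hf.integrableOn_indicator α x).mul_const _)
    ((hf.integrableOn_posPart α y).sub (hf.integrableOn_posPart α x)) measurableSet_Ioi
    fun p hp => ?_
  have hfp := (hf.pos p hp).le
  by_cases h : 0 < α + x * p
  · rw [indicator_of_mem (show p ∈ {p : ℝ | 0 < α + x * p} from h), max_eq_left h.le]
    have := mul_le_mul_of_nonneg_left (le_max_left (α + y * p) 0) hfp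
    nlinarith
  · rw [indicator_of_notMem (show p ∉ {p : ℝ | 0 < α + x * p} from h), max_eq_right (not_lt.1 h)]
    have := mul_nonneg hfp (le_max_right (α + y * p) 0)
    linarith

/-- The integrand is dominated by `p f(p)` and is continuous in `x` at all prices but `-α / x`. -/
theorem continuousAt_sourceSpend {α x : ℝ} (h : x ≠ 0 ∨ 0 < α) :
    ContinuousAt (sourceSpend α f) x := by
  refine continuousAt_of_dominated (bound := fun p => p * f p)
    (Eventually.of_forall fun y => (hf.integrableOn_indicator α y).aestronglyMeasurable)
    (Eventually.of_forall fun y => ?_) hf.integrableOn_mul ?_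
  · filter_upwards [ae_restrict_mem measurableSet_Ioi] with p hp
    refine (norm_indicator_le_norm_self _ _).trans ?_
    rw [Real.norm_of_nonneg (mul_nonneg (le_of_lt hp) (hf.pos p hp).le)]
  · have hne : ∀ᵐ p : ℝ, p ≠ -α / x := by
      simp [ae_iff, measure_singleton]
    filter_upwards [ae_restrict_of_ae hne] with p hp
    have hne0 : α + x * p ≠ 0 := by
      by_cases hx : x = 0
      · rcases h with h | h
        · exact absurd hx h
        · simp [hx, h.ne']
      · intro h0
        apply hp
        field_simp
        linarith
    have hc : ContinuousAt (fun y : ℝ => α + y * p) x := by fun_prop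
    rcases hne0.lt_or_gt with h0 | h0
    · refine (continuousAt_const (y := (0 : ℝ))).congr ?_
      filter_upwards [hc.eventually_lt_const h0] with y hy
      exact (indicator_of_notMem (show p ∉ {p : ℝ | 0 < α + y * p} from hy.not_gt)
        (fun p => p * f p)).symm
    · refine (continuousAt_const (y := p * f p)).congr ?_
      filter_upwards [hc.eventually_const_lt h0] with y hy
      exact (indicator_of_mem (show p ∈ {p : ℝ | 0 < α + y * p} from hy)
        (fun p => p * f p)).symm

/-- A source of weight `0` spends nothing for `x ≤ 0`, so continuity from the left holds at `0` even
though the spending rate jumps there. -/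
theorem continuousOn_sourceSpend {α : ℝ} (hα : 0 ≤ α) :
    ContinuousOn (sourceSpend α f) (Iic 0) := by
  rcases hα.lt_or_eq with hα | rfl
  · exact fun x _ => (hf.continuousAt_sourceSpend (Or.inr hα)).continuousWithinAt
  · refine (continuousOn_const (c := (0 : ℝ))).congr fun x hx => ?_
    rw [sourceSpend]
    refine setIntegral_eq_zero_of_forall_eq_zero fun p hp => ?_
    have : x * p ≤ 0 := mul_nonpos_of_nonpos_of_nonneg hx (le_of_lt hp)
    exact indicator_of_notMem (show p ∉ {p : ℝ | 0 < 0 + x * p} by simpa using this) _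

/-- A subgradient that is continuous at a point is the derivative there. -/
theorem hasDerivAt_sourceGain {α x : ℝ} (h : x ≠ 0 ∨ 0 < α) :
    HasDerivAt (sourceGain α f) (sourceSpend α f x) x := by
  rw [hasDerivAt_iff_isLittleO, Asymptotics.isLittleO_iff]
  intro c hc
  filter_upwards [Metric.continuousAt_iff'.1 (hf.continuousAt_sourceSpend h) c hc] with y hy
  have h1 := hf.sourceSpend_mul_sub_le α x y
  have h2 := hf.sourceSpend_mul_sub_le α y x
  rw [Real.dist_eq] at hy
  rw [smul_eq_mul, Real.norm_eq_abs, Real.norm_eq_abs, abs_of_nonneg (by linarith)]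
  calc _ ≤ (sourceSpend α f y - sourceSpend α f x) * (y - x) := by linarith
    _ ≤ |(sourceSpend α f y - sourceSpend α f x) * (y - x)| := le_abs_self _
    _ ≤ c * |y - x| := by
      rw [abs_mul]
      exact mul_le_mul_of_nonneg_right hy.le (abs_nonneg _)

theorem intervalIntegral_eq (α x : ℝ) (b : ℝ≥0) :
    ∫ p in (0 : ℝ)..b, f p * (α + x * p) = α * priceCDF f b + x * priceSpend f b := by
  rw [hf.linear_combination_eq, pricesUpTo_coe, intervalIntegral.integral_of_le b.coe_nonneg]

theorem isLUB_intervalIntegral {α : ℝ} (hα : 0 ≤ α) (x : ℝ) :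
    IsLUB (range fun b : ℝ≥0 => ∫ p in (0 : ℝ)..b, f p * (α + x * p)) (sourceGain α f x) := by
  constructor
  · rintro _ ⟨b, rfl⟩
    simp only [hf.intervalIntegral_eq]
    exact hf.linear_combination_le α x b
  · intro c hc
    rcases lt_or_ge x 0 with hx | hx
    · rw [← hf.linear_combination_optimalBid hα hx.le, optimalBid, if_pos hx]
      have := hc ⟨(-α / x).toNNReal, rfl⟩
      simp only [hf.intervalIntegral_eq] at this
      exact this
    -- for `x ≥ 0` the supremum is in general only approached as the bid tends to `+∞`
    · have hlim := intervalIntegral_tendsto_integral_Ioi 0 (hf.integrableOn_linear α x) tendsto_id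
      have heq : sourceGain α f x = ∫ p in Ioi 0, f p * (α + x * p) := by
        refine setIntegral_congr_fun measurableSet_Ioi fun p hp => ?_
        have : 0 ≤ x * p := mul_nonneg hx (le_of_lt hp)
        simp only [max_eq_left (add_nonneg hα this)]
      rw [heq]
      refine le_of_tendsto hlim ?_
      filter_upwards [eventually_ge_atTop 0] with b hb
      exact hc ⟨⟨b, hb⟩, rfl⟩

theorem iSup_intervalIntegral {α : ℝ} (hα : 0 ≤ α) (x : ℝ) :
    ⨆ b : ℝ≥0, ∫ p in (0 : ℝ)..b, f p * (α + x * p) = sourceGain α f x :=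
  (hf.isLUB_intervalIntegral hα x).csSup_eq (range_nonempty _)

theorem iInf_neg_intervalIntegral {α : ℝ} (hα : 0 ≤ α) (x : ℝ) :
    ⨅ b : ℝ≥0, -∫ p in (0 : ℝ)..b, f p * (α + p * x) = -sourceGain α f x := by
  have h := (hf.isLUB_intervalIntegral hα x).neg
  refine IsGLB.csInf_eq ?_ (range_nonempty _)
  convert h using 1
  ext c
  simp [mul_comm x, neg_eq_iff_eq_neg]

end IsPriceDensity

/-! ### The Hamiltonian and the costate -/

/-- The standing assumptions on the sources: positive arrival rates, nonnegative weights, and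
price densities. -/
structure IsSourceFamily {J : ℕ} (lam α : Fin J → ℝ) (f : Fin J → ℝ → ℝ) : Prop where
  rate_pos : ∀ j, 0 < lam j
  weight_nonneg : ∀ j, 0 ≤ α j
  density : ∀ j, IsPriceDensity (f j)

/-- The total spending rate `∑ λ^j ∫_{α^j + x p > 0} p f^j(p) dp`, a subgradient of `H` at `x`. -/
def totalSpend {J : ℕ} (lam α : Fin J → ℝ) (f : Fin J → ℝ → ℝ) (x : ℝ) : ℝ :=
  ∑ j, lam j * sourceSpend (α j) (f j) x

/-- The largest possible spending rate `∑ λ^j ∫_0^∞ p f^j(p) dp`. -/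
def maxSpend {J : ℕ} (lam : Fin J → ℝ) (f : Fin J → ℝ → ℝ) : ℝ := ∑ j, lam j * meanPrice (f j)

/-- The dual objective `S x - τ H(x) - x² / (4K)`, where `τ` is the remaining time. -/
def dualObjective {J : ℕ} (lam α : Fin J → ℝ) (f : Fin J → ℝ → ℝ) (K τ S x : ℝ) : ℝ :=
  S * x - τ * hamiltonian lam α f x - x ^ 2 / (4 * K)

/-- The first-order conditions for `x` to maximize `dualObjective lam α f K τ S` over `x ≤ 0`. Such
an `x` is the constant costate of the fluid problem with remaining time `τ` and cash `S`. -/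
structure IsCostate {J : ℕ} (lam α : Fin J → ℝ) (f : Fin J → ℝ → ℝ) (K τ S x : ℝ) : Prop where
  nonpos : x ≤ 0
  slope_le : τ * totalSpend lam α f x + x / (2 * K) ≤ S
  slope_eq : x < 0 → S = τ * totalSpend lam α f x + x / (2 * K)

variable {J : ℕ} {lam α : Fin J → ℝ} {f : Fin J → ℝ → ℝ} {K T τ t S x y : ℝ}
  {b : Fin J → ℝ → ℝ≥0∞} {w : ℝ → ℝ → ℝ}

namespace IsSourceFamily

theorem hamiltonian_eq (hm : IsSourceFamily lam α f) (x : ℝ) :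
    hamiltonian lam α f x = ∑ j, lam j * sourceGain (α j) (f j) x :=
  Finset.sum_congr rfl fun j _ => by
    rw [sourceHamiltonian, (hm.density j).iSup_intervalIntegral (hm.weight_nonneg j)]

theorem hjOperator_eq (hm : IsSourceFamily lam α f) (vt vS : ℝ) :
    hjOperator lam α f vt vS = -vt + hamiltonian lam α f vS := by
  rw [hjOperator, hm.hamiltonian_eq, sub_eq_add_neg, ← Finset.sum_neg_distrib]
  congr 1
  refine Finset.sum_congr rfl fun j _ => ?_
  rw [(hm.density j).iInf_neg_intervalIntegral (hm.weight_nonneg j)]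
  ring

theorem totalSpend_mul_sub_le (hm : IsSourceFamily lam α f) (x y : ℝ) :
    totalSpend lam α f x * (y - x) ≤ hamiltonian lam α f y - hamiltonian lam α f x := by
  rw [hm.hamiltonian_eq, hm.hamiltonian_eq, totalSpend, Finset.sum_mul, ← Finset.sum_sub_distrib]
  refine Finset.sum_le_sum fun j _ => ?_
  rw [← mul_sub, mul_assoc]
  exact mul_le_mul_of_nonneg_left ((hm.density j).sourceSpend_mul_sub_le _ x y)
    (hm.rate_pos j).le

theorem totalSpend_nonneg (hm : IsSourceFamily lam α f) (x : ℝ) : 0 ≤ totalSpend lam α f x :=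
  Finset.sum_nonneg fun j _ =>
    mul_nonneg (hm.rate_pos j).le ((hm.density j).sourceSpend_nonneg _ _)

theorem totalSpend_le (hm : IsSourceFamily lam α f) (x : ℝ) :
    totalSpend lam α f x ≤ maxSpend lam f :=
  Finset.sum_le_sum fun j _ =>
    mul_le_mul_of_nonneg_left ((hm.density j).sourceSpend_le _ _) (hm.rate_pos j).le

theorem maxSpend_nonneg (hm : IsSourceFamily lam α f) : 0 ≤ maxSpend lam f :=
  (hm.totalSpend_nonneg 0).trans (hm.totalSpend_le 0)

theorem totalSpend_mono (hm : IsSourceFamily lam α f) : Monotone (totalSpend lam α f) := by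
  intro x y hxy
  rcases hxy.lt_or_eq with hxy | rfl
  · have h1 := hm.totalSpend_mul_sub_le x y
    have h2 := hm.totalSpend_mul_sub_le y x
    exact le_of_mul_le_mul_right (by linarith) (sub_pos.2 hxy)
  · exact le_rfl

theorem monotone_hamiltonian (hm : IsSourceFamily lam α f) : Monotone (hamiltonian lam α f) := by
  intro x y hxy
  have h1 := hm.totalSpend_mul_sub_le x y
  have h2 := mul_nonneg (hm.totalSpend_nonneg x) (sub_nonneg.2 hxy)
  linarith

theorem hamiltonian_nonneg (hm : IsSourceFamily lam α f) (x : ℝ) : 0 ≤ hamiltonian lam α f x := by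
  rw [hm.hamiltonian_eq]
  refine Finset.sum_nonneg fun j _ => mul_nonneg (hm.rate_pos j).le ?_
  exact setIntegral_nonneg measurableSet_Ioi fun p hp =>
    mul_nonneg ((hm.density j).pos p hp).le (le_max_right _ _)

theorem abs_hamiltonian_sub_le (hm : IsSourceFamily lam α f) (x y : ℝ) :
    |hamiltonian lam α f y - hamiltonian lam α f x| ≤ maxSpend lam f * |y - x| := by
  wlog h : x ≤ y generalizing x y
  · rw [abs_sub_comm, abs_sub_comm y]
    exact this y x (le_of_not_ge h)
  rw [abs_of_nonneg (sub_nonneg.2 (hm.monotone_hamiltonian h)), abs_of_nonneg (sub_nonneg.2 h)]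
  have h1 := hm.totalSpend_mul_sub_le y x
  have h2 := mul_le_mul_of_nonneg_right (hm.totalSpend_le y) (sub_nonneg.2 h)
  linarith

theorem continuousOn_totalSpend (hm : IsSourceFamily lam α f) :
    ContinuousOn (totalSpend lam α f) (Iic 0) :=
  continuousOn_finsetSum _ fun j _ =>
    continuousOn_const.mul ((hm.density j).continuousOn_sourceSpend (hm.weight_nonneg j))

theorem hasDerivAt_hamiltonian (hm : IsSourceFamily lam α f) (h : x ≠ 0 ∨ ∀ j, 0 < α j) :
    HasDerivAt (hamiltonian lam α f) (totalSpend lam α f x) x := by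
  rw [funext hm.hamiltonian_eq]
  refine HasDerivAt.fun_sum fun j _ => HasDerivAt.const_mul _ ?_
  exact (hm.density j).hasDerivAt_sourceGain (h.imp id fun h => h j)

/-- If the slope at `0` is at most `S` then `0` is a costate; otherwise the intermediate value theorem
gives a negative one. -/
theorem exists_isCostate (hm : IsSourceFamily lam α f) (hK : 0 < K) (hτ : 0 ≤ τ) (S : ℝ) :
    ∃ x, IsCostate lam α f K τ S x := by
  by_cases h : τ * totalSpend lam α f 0 ≤ S
  · exact ⟨0, le_rfl, by simpa using h, fun h => absurd h (lt_irrefl _)⟩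
  -- at this `M` the slope is below `S` since the spending rate is at most `maxSpend`
  set M := min (2 * K * (S - τ * maxSpend lam f)) 0 with hM
  have hM0 : M ≤ 0 := min_le_right _ _
  have hcont : ContinuousOn (fun x => τ * totalSpend lam α f x + x / (2 * K)) (Icc M 0) :=
    (continuousOn_const.mul (hm.continuousOn_totalSpend.mono Icc_subset_Iic_self)).add
      (by fun_prop)
  have hlow : τ * totalSpend lam α f M + M / (2 * K) ≤ S := by
    have h1 := mul_le_mul_of_nonneg_left (hm.totalSpend_le M) hτ
    have h2 : M / (2 * K) ≤ S - τ * maxSpend lam f := by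
      rw [div_le_iff₀ (by positivity)]
      exact (min_le_left _ _).trans (by linarith)
    linarith
  obtain ⟨x, hx, hxS⟩ := intermediate_value_Icc hM0 hcont
    ⟨hlow, by simpa using (not_le.1 h).le⟩
  exact ⟨x, hx.2, hxS.le, fun _ => hxS.symm⟩

/-- Convexity of `H` makes the dual objective strongly concave. -/
theorem dualObjective_add_sq_le (hm : IsSourceFamily lam α f) (hK : 0 < K) (hτ : 0 ≤ τ)
    (hx : IsCostate lam α f K τ S x) (hy : y ≤ 0) :
    dualObjective lam α f K τ S y + (y - x) ^ 2 / (4 * K) ≤ dualObjective lam α f K τ S x := by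
  have h1 := mul_le_mul_of_nonneg_left (hm.totalSpend_mul_sub_le x y) hτ
  have h2 : (x - y) * (x / (2 * K)) ≤ (x - y) * (S - τ * totalSpend lam α f x) := by
    rcases hx.nonpos.lt_or_eq with h | h
    · rw [hx.slope_eq h]
      exact le_of_eq (by ring)
    · have := hx.slope_le
      refine mul_le_mul_of_nonneg_left (by linarith) (by linarith)
  have h3 : (x - y) * (x / (2 * K)) = (x ^ 2 - y ^ 2 + (y - x) ^ 2) / (4 * K) := by
    field_simp
    ring
  have h4 : (x ^ 2 - y ^ 2 + (y - x) ^ 2) / (4 * K) =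
      x ^ 2 / (4 * K) - y ^ 2 / (4 * K) + (y - x) ^ 2 / (4 * K) := by ring
  unfold dualObjective
  linarith

theorem dualObjective_le (hm : IsSourceFamily lam α f) (hK : 0 < K) (hτ : 0 ≤ τ)
    (hx : IsCostate lam α f K τ S x) (hy : y ≤ 0) :
    dualObjective lam α f K τ S y ≤ dualObjective lam α f K τ S x := by
  have := hm.dualObjective_add_sq_le hK hτ hx hy
  have : 0 ≤ (y - x) ^ 2 / (4 * K) := by positivity
  linarith

/-- The costate is a Lipschitz function of remaining time and cash: add the two strong concavity
inequalities. -/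
theorem abs_costate_sub_le (hm : IsSourceFamily lam α f) (hK : 0 < K) {τ' S' : ℝ} (hτ : 0 ≤ τ)
    (hτ' : 0 ≤ τ') (hx : IsCostate lam α f K τ S x) (hy : IsCostate lam α f K τ' S' y) :
    |y - x| ≤ 2 * K * (|S' - S| + maxSpend lam f * |τ' - τ|) := by
  have h1 := hm.dualObjective_add_sq_le hK hτ hx hy.nonpos
  have h2 := hm.dualObjective_add_sq_le hK hτ' hy hx.nonpos
  have h3 : (y - x) ^ 2 / (4 * K) + (x - y) ^ 2 / (4 * K) = |y - x| * |y - x| / (2 * K) := by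
    rw [abs_mul_abs_self]
    field_simp
    ring
  have h4 : |y - x| * |y - x| / (2 * K) ≤
      |y - x| * (|S' - S| + maxSpend lam f * |τ' - τ|) := by
    have h5 : (S' - S) * (y - x) ≤ |S' - S| * |y - x| := by
      rw [← abs_mul]
      exact le_abs_self _
    have h6 : -((τ' - τ) * (hamiltonian lam α f y - hamiltonian lam α f x)) ≤
        |τ' - τ| * (maxSpend lam f * |y - x|) := by
      refine (neg_le_abs _).trans ?_
      rw [abs_mul]
      exact mul_le_mul_of_nonneg_left (hm.abs_hamiltonian_sub_le x y) (abs_nonneg _)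
    unfold dualObjective at h1 h2
    linarith
  rcases (abs_nonneg (y - x)).lt_or_eq with h0 | h0
  · rw [div_le_iff₀ (by positivity)] at h4
    exact le_of_mul_le_mul_left (h4.trans_eq (by ring)) h0
  · rw [← h0]
    have := hm.maxSpend_nonneg
    positivity

end IsSourceFamily

/-! ### Dual bound and optimal constant controls -/

theorem IsControl.intervalIntegrable_priceCDF (hb : IsControl t T b) (htT : t ≤ T) (j : Fin J)
    (hf : IsPriceDensity (f j)) :
    IntervalIntegrable (fun s => priceCDF (f j) (b j s)) volume t T := by
  rw [intervalIntegrable_iff_integrableOn_Icc_of_le htT]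
  refine Integrable.of_bound
    (hf.monotone_priceCDF.measurable.comp_aemeasurable (hb j)).aestronglyMeasurable 1
    (ae_of_all _ fun s => ?_)
  rw [Real.norm_of_nonneg (hf.priceCDF_nonneg _)]
  exact hf.priceCDF_le_one _

theorem IsControl.intervalIntegrable_priceSpend (hb : IsControl t T b) (htT : t ≤ T) (j : Fin J)
    (hf : IsPriceDensity (f j)) :
    IntervalIntegrable (fun s => priceSpend (f j) (b j s)) volume t T := by
  rw [intervalIntegrable_iff_integrableOn_Icc_of_le htT]
  refine Integrable.of_bound
    (hf.monotone_priceSpend.measurable.comp_aemeasurable (hb j)).aestronglyMeasurable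
    (meanPrice (f j)) (ae_of_all _ fun s => ?_)
  rw [Real.norm_of_nonneg (hf.priceSpend_nonneg _)]
  exact hf.priceSpend_le _

theorem isControl_const (c : Fin J → ℝ≥0∞) : IsControl t T (fun j _ => c j) :=
  fun _ => aemeasurable_const

/-- The rate at which the control `b` falls short of the Hamiltonian at time `s`, for the
costate `x`. -/
def hamiltonianGap (lam α : Fin J → ℝ) (f : Fin J → ℝ → ℝ) (x : ℝ) (b : Fin J → ℝ → ℝ≥0∞)
    (s : ℝ) : ℝ :=
  ∑ j, lam j * (sourceGain (α j) (f j) x -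
    (α j * priceCDF (f j) (b j s) + x * priceSpend (f j) (b j s)))

/-- The Fenchel gap between the terminal penalty `K min(y, 0)²` and `x y - x² / (4K)`. -/
theorem terminal_gap_nonneg (hK : 0 < K) (hx : x ≤ 0) (y : ℝ) :
    0 ≤ K * min y 0 ^ 2 - x * y + x ^ 2 / (4 * K) := by
  have h0 : 0 ≤ x ^ 2 / (4 * K) := by positivity
  rcases le_total y 0 with hy | hy
  · rw [min_eq_left hy]
    have : K * y ^ 2 - x * y + x ^ 2 / (4 * K) = K * (y - x / (2 * K)) ^ 2 := by
      field_simp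
      ring
    rw [this]
    positivity
  · rw [min_eq_right hy]
    nlinarith [mul_nonneg (neg_nonneg.2 hx) hy]

/-- The first-order conditions say that the cash left at the end by the spending rate
`totalSpend lam α f x` is conjugate to `x` for the terminal penalty. -/
theorem terminal_gap_eq_zero (hK : 0 < K) (hx : IsCostate lam α f K τ S x) :
    K * min (S - τ * totalSpend lam α f x) 0 ^ 2 - x * (S - τ * totalSpend lam α f x) +
      x ^ 2 / (4 * K) = 0 := by
  rcases hx.nonpos.lt_or_eq with h | rfl
  · have h2 : S - τ * totalSpend lam α f x = x / (2 * K) := by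
      have := hx.slope_eq h
      linarith
    rw [h2, min_eq_left (div_nonpos_of_nonpos_of_nonneg h.le (by positivity))]
    field_simp
    ring
  · have := hx.slope_le
    rw [zero_div, add_zero] at this
    rw [min_eq_right (sub_nonneg.2 this)]
    simp

namespace IsSourceFamily

theorem hamiltonianGap_nonneg (hm : IsSourceFamily lam α f) (x : ℝ) (b : Fin J → ℝ → ℝ≥0∞)
    (s : ℝ) : 0 ≤ hamiltonianGap lam α f x b s :=
  Finset.sum_nonneg fun j _ => mul_nonneg (hm.rate_pos j).le
    (sub_nonneg.2 ((hm.density j).linear_combination_le _ _ _))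

theorem intervalIntegrable_hamiltonianGap_term (hm : IsSourceFamily lam α f)
    (hb : IsControl t T b) (htT : t ≤ T) (j : Fin J) :
    IntervalIntegrable (fun s => lam j * (sourceGain (α j) (f j) x -
      (α j * priceCDF (f j) (b j s) + x * priceSpend (f j) (b j s)))) volume t T :=
  ((intervalIntegrable_const).sub (((hb.intervalIntegrable_priceCDF htT j
    (hm.density j)).const_mul _).add ((hb.intervalIntegrable_priceSpend htT j
    (hm.density j)).const_mul _))).const_mul _

theorem intervalIntegrable_hamiltonianGap (hm : IsSourceFamily lam α f)
    (hb : IsControl t T b) (htT : t ≤ T) :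
    IntervalIntegrable (hamiltonianGap lam α f x b) volume t T := by
  have h := IntervalIntegrable.sum Finset.univ fun j _ =>
    hm.intervalIntegrable_hamiltonianGap_term (x := x) hb htT j
  refine h.congr fun s _ => ?_
  simp [hamiltonianGap]

theorem fluidCash_eq (hm : IsSourceFamily lam α f) (hb : IsControl t T b) (htT : t ≤ T) :
    fluidCash lam f t S b T = S - ∑ j, lam j * ∫ s in t..T, priceSpend (f j) (b j s) := by
  rw [fluidCash, intervalIntegral.integral_finsetSum fun j _ =>
    (hb.intervalIntegrable_priceSpend htT j (hm.density j)).const_mul _]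
  simp only [intervalIntegral.integral_const_mul]

/-- The cost of a control exceeds the dual objective at `x` by the accumulated Hamiltonian gap and
the terminal Fenchel gap. -/
theorem fluidCost_eq (hm : IsSourceFamily lam α f) (hb : IsControl t T b) (htT : t ≤ T)
    (K S x : ℝ) :
    fluidCost lam α f K T t S b = dualObjective lam α f K (T - t) S x +
      (∫ s in t..T, hamiltonianGap lam α f x b s) +
      (K * min (fluidCash lam f t S b T) 0 ^ 2 - x * fluidCash lam f t S b T +
        x ^ 2 / (4 * K)) := by
  have h1 : ∫ s in t..T, hamiltonianGap lam α f x b s =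
      (T - t) * (∑ j, lam j * sourceGain (α j) (f j) x) -
      (∑ j, lam j * α j * ∫ s in t..T, priceCDF (f j) (b j s)) -
      x * ∑ j, lam j * ∫ s in t..T, priceSpend (f j) (b j s) := by
    unfold hamiltonianGap
    rw [intervalIntegral.integral_finsetSum fun j _ =>
      hm.intervalIntegrable_hamiltonianGap_term hb htT j, Finset.mul_sum, Finset.mul_sum,
      ← Finset.sum_sub_distrib, ← Finset.sum_sub_distrib]
    refine Finset.sum_congr rfl fun j _ => ?_
    have hF := (hb.intervalIntegrable_priceCDF htT j (hm.density j)).const_mul (α j)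
    have hG := (hb.intervalIntegrable_priceSpend htT j (hm.density j)).const_mul x
    rw [intervalIntegral.integral_const_mul,
      intervalIntegral.integral_sub intervalIntegrable_const (hF.add hG),
      intervalIntegral.integral_add hF hG, intervalIntegral.integral_const_mul,
      intervalIntegral.integral_const_mul, intervalIntegral.integral_const, smul_eq_mul]
    ring
  rw [fluidCost, dualObjective, h1, hm.hamiltonian_eq]
  have h2 := hm.fluidCash_eq (S := S) hb htT
  set c := fluidCash lam f t S b T
  linear_combination x * h2

theorem dualObjective_le_fluidCost (hm : IsSourceFamily lam α f) (hK : 0 < K)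
    (hb : IsControl t T b) (htT : t ≤ T) (hx : x ≤ 0) (S : ℝ) :
    dualObjective lam α f K (T - t) S x ≤ fluidCost lam α f K T t S b := by
  rw [hm.fluidCost_eq hb htT K S x]
  have h1 := intervalIntegral.integral_nonneg (μ := volume) htT
    fun s _ => hm.hamiltonianGap_nonneg x b s
  have h2 := terminal_gap_nonneg hK hx (fluidCash lam f t S b T)
  linarith

theorem sum_priceSpend_optimalBid (hm : IsSourceFamily lam α f) (hx : x ≤ 0) :
    ∑ j, lam j * priceSpend (f j) (optimalBid (α j) x) = totalSpend lam α f x :=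
  Finset.sum_congr rfl fun j _ => by
    rw [priceSpend_optimalBid (f j) (hm.weight_nonneg j) hx]

theorem fluidCash_optimalBid (hm : IsSourceFamily lam α f) (hx : x ≤ 0) (s : ℝ) :
    fluidCash lam f t S (fun j _ => optimalBid (α j) x) s = S - (s - t) * totalSpend lam α f x := by
  rw [fluidCash, intervalIntegral.integral_const, hm.sum_priceSpend_optimalBid hx, smul_eq_mul]

/-- Both gaps vanish when each source bids the maximizer for the costate. -/
theorem fluidCost_optimalBid (hm : IsSourceFamily lam α f) (hK : 0 < K) (htT : t ≤ T)
    (hx : IsCostate lam α f K (T - t) S x) :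
    fluidCost lam α f K T t S (fun j _ => optimalBid (α j) x) =
      dualObjective lam α f K (T - t) S x := by
  rw [hm.fluidCost_eq (isControl_const _) htT K S x, hm.fluidCash_optimalBid hx.nonpos]
  have h1 : ∀ s, hamiltonianGap lam α f x (fun j _ => optimalBid (α j) x) s = 0 := fun s =>
    Finset.sum_eq_zero fun j _ => by
      rw [(hm.density j).linear_combination_optimalBid (hm.weight_nonneg j) hx.nonpos, sub_self,
        mul_zero]
  simp only [h1, intervalIntegral.integral_zero, add_zero]
  rw [add_eq_left]
  exact terminal_gap_eq_zero hK hx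

theorem isOptimalControl_optimalBid (hm : IsSourceFamily lam α f) (hK : 0 < K) (htT : t ≤ T)
    (hx : IsCostate lam α f K (T - t) S x) :
    IsOptimalControl lam α f K T t S (fun j _ => optimalBid (α j) x) := by
  refine ⟨isControl_const _, fun b' hb' => ?_⟩
  rw [hm.fluidCost_optimalBid hK htT hx]
  exact hm.dualObjective_le_fluidCost hK hb' htT hx.nonpos S

/-- Here the sources of weight `0` also bid `+∞`: they do not enter the objective, and the cash stays
nonnegative nevertheless. -/
theorem isOptimalControl_top (hm : IsSourceFamily lam α f) (hK : 0 < K) (htT : t ≤ T)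
    (hS : (T - t) * maxSpend lam f ≤ S) : IsOptimalControl lam α f K T t S (fun _ _ => ⊤) := by
  refine ⟨isControl_const _, fun b' hb' => ?_⟩
  refine le_trans (le_of_eq ?_) (hm.dualObjective_le_fluidCost hK hb' htT le_rfl S)
  have hcash : fluidCash lam f t S (fun _ _ => ⊤) T = S - (T - t) * maxSpend lam f := by
    simp [fluidCash, priceSpend_top, maxSpend]
  have h1 : ∀ s, hamiltonianGap lam α f 0 (fun _ _ => ⊤) s = 0 := fun s =>
    Finset.sum_eq_zero fun j _ => by
      have h2 : sourceGain (α j) (f j) 0 = α j := by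
        simp [sourceGain, max_eq_left (hm.weight_nonneg j), integral_mul_const,
          (hm.density j).integral_eq_one]
      rw [h2, (hm.density j).priceCDF_top]
      ring
  rw [hm.fluidCost_eq (isControl_const _) htT K S 0, hcash, min_eq_right (sub_nonneg.2 hS)]
  simp [h1]

theorem fluidValue_eq (hm : IsSourceFamily lam α f) (hK : 0 < K) (htT : t ≤ T)
    (hx : IsCostate lam α f K (T - t) S x) :
    fluidValue lam α f K T t S = dualObjective lam α f K (T - t) S x := by
  refine IsLeast.csInf_eq ⟨⟨_, isControl_const _, (hm.fluidCost_optimalBid hK htT hx).symm⟩, ?_⟩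
  rintro _ ⟨b, hb, rfl⟩
  exact hm.dualObjective_le_fluidCost hK hb htT hx.nonpos S

theorem isLUB_fluidValue (hm : IsSourceFamily lam α f) (hK : 0 < K) (htT : t ≤ T) (S : ℝ) :
    IsLUB (dualObjective lam α f K (T - t) S '' Iic 0) (fluidValue lam α f K T t S) := by
  obtain ⟨x, hx⟩ := hm.exists_isCostate hK (sub_nonneg.2 htT) S
  rw [hm.fluidValue_eq hK htT hx]
  refine IsGreatest.isLUB ⟨mem_image_of_mem _ hx.nonpos, ?_⟩
  rintro _ ⟨y, hy, rfl⟩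
  exact hm.dualObjective_le hK (sub_nonneg.2 htT) hx hy

/-- With positive weights the maximizing bids are unique, so a vanishing Hamiltonian gap forces
them. -/
theorem eq_optimalBid_of_isOptimalControl (hm : IsSourceFamily lam α f) (hα : ∀ j, 0 < α j)
    (hK : 0 < K) (htT : t ≤ T) (hx : IsCostate lam α f K (T - t) S x)
    (hb : IsOptimalControl lam α f K T t S b) (j : Fin J) :
    ∀ᵐ s ∂(volume.restrict (Icc t T)), b j s = optimalBid (α j) x := by
  have hle := hb.2 _ (isControl_const fun j => optimalBid (α j) x)
  rw [hm.fluidCost_optimalBid hK htT hx, hm.fluidCost_eq hb.1 htT K S x] at hle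
  have h2 := terminal_gap_nonneg hK hx.nonpos (fluidCash lam f t S b T)
  have h0 : ∫ s in t..T, hamiltonianGap lam α f x b s = 0 :=
    le_antisymm (by linarith) (intervalIntegral.integral_nonneg (μ := volume) htT
      fun s _ => hm.hamiltonianGap_nonneg x b s)
  rw [intervalIntegral.integral_of_le htT, ← integral_Icc_eq_integral_Ioc,
    integral_eq_zero_iff_of_nonneg (fun s => hm.hamiltonianGap_nonneg x b s)
    ((intervalIntegrable_iff_integrableOn_Icc_of_le htT).1
      (hm.intervalIntegrable_hamiltonianGap hb.1 htT))] at h0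
  filter_upwards [h0] with s hs
  have hj := (Finset.sum_eq_zero_iff_of_nonneg fun j _ => mul_nonneg (hm.rate_pos j).le
    (sub_nonneg.2 ((hm.density j).linear_combination_le (α j) x (b j s)))).1 hs j
    (Finset.mem_univ j)
  refine (hm.density j).eq_optimalBid (hα j) hx.nonpos ?_
  have := (mul_eq_zero.1 hj).resolve_left (hm.rate_pos j).ne'
  linarith

end IsSourceFamily

/-! ### Regularity of the value function -/

namespace IsSourceFamily

/-- The value function is a supremum of affine functions of `(t, S)`, and the costate selects the
one that touches it at `(t, S)`. -/
theorem le_fluidValue_sub (hm : IsSourceFamily lam α f) (hK : 0 < K) (htT : t ≤ T) {t' : ℝ}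
    (htT' : t' ≤ T) (hx : IsCostate lam α f K (T - t) S x) (S' : ℝ) :
    (S' - S) * x + (t' - t) * hamiltonian lam α f x ≤
      fluidValue lam α f K T t' S' - fluidValue lam α f K T t S := by
  have h1 := (hm.isLUB_fluidValue hK htT' S').1 (mem_image_of_mem _ hx.nonpos)
  rw [hm.fluidValue_eq hK htT hx]
  unfold dualObjective at *
  linarith

theorem abs_costate_le (hm : IsSourceFamily lam α f) (hK : 0 < K) (hτ : 0 ≤ τ)
    (hx : IsCostate lam α f K τ S x) : |x| ≤ 2 * K * (|S| + maxSpend lam f * τ) := by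
  have h0 : IsCostate lam α f K 0 0 0 := ⟨le_rfl, by simp, fun h => absurd h (lt_irrefl _)⟩
  have := hm.abs_costate_sub_le hK le_rfl hτ h0 hx
  simpa [abs_of_nonneg hτ] using this

theorem lipschitzOnWith_fluidValue (hm : IsSourceFamily lam α f) (hK : 0 < K) (R : ℝ) :
    ∃ L : ℝ≥0, LipschitzOnWith L (Function.uncurry (fluidValue lam α f K T))
      (Icc 0 T ×ˢ Icc (-R) R) := by
  set M := 2 * K * (R + maxSpend lam f * T) with hM
  have key : ∀ p ∈ Icc 0 T ×ˢ Icc (-R) R, ∀ q ∈ Icc 0 T ×ˢ Icc (-R) R,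
      Function.uncurry (fluidValue lam α f K T) p - Function.uncurry (fluidValue lam α f K T) q ≤
        (M + hamiltonian lam α f 0) * dist p q := by
    rintro ⟨t, S⟩ ⟨ht, hS⟩ ⟨t', S'⟩ ⟨ht', -⟩
    simp only at ht hS ht'
    obtain ⟨x, hx⟩ := hm.exists_isCostate hK (sub_nonneg.2 ht.2) S
    have h1 := hm.le_fluidValue_sub hK ht.2 ht'.2 hx S'
    have hxM : |x| ≤ M := by
      refine (hm.abs_costate_le hK (sub_nonneg.2 ht.2) hx).trans ?_
      have h2 : |S| ≤ R := abs_le.2 hS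
      have h3 : maxSpend lam f * (T - t) ≤ maxSpend lam f * T :=
        mul_le_mul_of_nonneg_left (by linarith [ht.1]) hm.maxSpend_nonneg
      exact mul_le_mul_of_nonneg_left (by linarith) (by positivity)
    have hd1 : |t - t'| ≤ dist (t, S) (t', S') := le_max_left _ _
    have hd2 : |S - S'| ≤ dist (t, S) (t', S') := le_max_right _ _
    have h4 : (S - S') * x ≤ dist (t, S) (t', S') * M := by
      refine (le_abs_self _).trans ?_
      rw [abs_mul]
      exact mul_le_mul hd2 hxM (abs_nonneg _) dist_nonneg
    have h5 : (t - t') * hamiltonian lam α f x ≤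
        dist (t, S) (t', S') * hamiltonian lam α f 0 := by
      refine (le_abs_self _).trans ?_
      rw [abs_mul, abs_of_nonneg (hm.hamiltonian_nonneg x)]
      exact mul_le_mul hd1 (hm.monotone_hamiltonian hx.nonpos) (hm.hamiltonian_nonneg x)
        dist_nonneg
    simp only [Function.uncurry]
    linarith
  refine ⟨(M + hamiltonian lam α f 0).toNNReal, LipschitzOnWith.of_dist_le_mul fun p hp q hq => ?_⟩
  have hle := mul_le_mul_of_nonneg_right (Real.le_coe_toNNReal (M + hamiltonian lam α f 0))
    (dist_nonneg (x := p) (y := q))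
  rw [Real.dist_eq, abs_sub_le_iff]
  exact ⟨(key p hp q hq).trans hle, (dist_comm p q ▸ key q hq p hp).trans hle⟩

theorem fluidValue_terminal (hm : IsSourceFamily lam α f) (hK : 0 < K) (S : ℝ) :
    fluidValue lam α f K T T S = K * min S 0 ^ 2 := by
  have h1 : 2 * K * min S 0 / (2 * K) = min S 0 := by field_simp
  have hx : IsCostate lam α f K (T - T) S (2 * K * min S 0) := by
    refine ⟨mul_nonpos_of_nonneg_of_nonpos (by positivity) (min_le_right _ _), ?_, fun h => ?_⟩
    · rw [h1]
      simp
    · rw [h1, min_eq_left]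
      · simp
      · by_contra hS
        rw [min_eq_right (not_le.1 hS).le] at h
        simp at h
  rw [hm.fluidValue_eq hK le_rfl hx, dualObjective, sub_self]
  have h2 : S * min S 0 = min S 0 * min S 0 := by
    rcases le_total S 0 with h | h
    · rw [min_eq_left h]
    · rw [min_eq_right h]
      simp
  field_simp
  linear_combination 8 * K * h2

/-- The gradient of the value function is `(H(x), x)` for the costate `x`; the error is quadratic
because the costate is Lipschitz. -/
theorem hasFDerivAt_fluidValue (hm : IsSourceFamily lam α f) (hK : 0 < K) (ht : t < T)
    (hx : IsCostate lam α f K (T - t) S x) :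
    HasFDerivAt (Function.uncurry (fluidValue lam α f K T))
      (hamiltonian lam α f x • ContinuousLinearMap.fst ℝ ℝ ℝ +
        x • ContinuousLinearMap.snd ℝ ℝ ℝ) (t, S) := by
  set L := maxSpend lam f with hL
  have hL0 : 0 ≤ L := hm.maxSpend_nonneg
  rw [hasFDerivAt_iff_isLittleO, Asymptotics.isLittleO_iff]
  intro c hc
  have hr : 0 < c / (2 * K * (1 + L) ^ 2) := by positivity
  have hev : ∀ᶠ q : ℝ × ℝ in 𝓝 (t, S), q.1 < T :=
    continuousAt_fst.eventually_lt_const ht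
  filter_upwards [hev, Metric.ball_mem_nhds (t, S) hr] with ⟨t', S'⟩ ht' hq
  rw [Metric.mem_ball, dist_eq_norm] at hq
  obtain ⟨y, hy⟩ := hm.exists_isCostate hK (sub_nonneg.2 (le_of_lt ht')) S'
  have h1 := hm.le_fluidValue_sub hK ht.le (le_of_lt ht') hx S'
  have h2 := hm.le_fluidValue_sub hK (le_of_lt ht') ht.le hy S
  have h3 := hm.abs_costate_sub_le hK (sub_nonneg.2 ht.le) (sub_nonneg.2 (le_of_lt ht')) hx hy
  have h4 := hm.abs_hamiltonian_sub_le x y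
  set N := ‖((t', S') : ℝ × ℝ) - (t, S)‖ with hN
  have hN1 : |t' - t| ≤ N := le_max_left _ _
  have hN2 : |S' - S| ≤ N := le_max_right _ _
  have hN0 : 0 ≤ N := norm_nonneg _
  have h5 : |y - x| ≤ 2 * K * ((1 + L) * N) := by
    refine h3.trans (mul_le_mul_of_nonneg_left ?_ (by positivity))
    have : |T - t' - (T - t)| ≤ N := by
      rw [abs_sub_comm]
      simpa using hN1
    nlinarith [mul_le_mul_of_nonneg_left this hL0]
  have h6 : (S' - S) * (y - x) ≤ N * (2 * K * ((1 + L) * N)) := by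
    refine (le_abs_self _).trans ?_
    rw [abs_mul]
    exact mul_le_mul hN2 h5 (abs_nonneg _) hN0
  have h7 : (t' - t) * (hamiltonian lam α f y - hamiltonian lam α f x) ≤
      N * (L * (2 * K * ((1 + L) * N))) := by
    refine (le_abs_self _).trans ?_
    rw [abs_mul]
    exact mul_le_mul hN1 (h4.trans (mul_le_mul_of_nonneg_left h5 hL0)) (abs_nonneg _) hN0
  have h8 : 2 * K * (1 + L) ^ 2 * N ≤ c := by
    rw [lt_div_iff₀ (by positivity)] at hq
    linarith
  have h9 := mul_le_mul_of_nonneg_right h8 hN0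
  simp only [Function.uncurry, add_apply, smul_apply,
    ContinuousLinearMap.coe_fst', ContinuousLinearMap.coe_snd', Prod.fst_sub, Prod.snd_sub,
    smul_eq_mul]
  rw [Real.norm_eq_abs, abs_of_nonneg (by linarith)]
  linarith

theorem fluidValue_second_difference_le (hm : IsSourceFamily lam α f) (hK : 0 < K) (htT : t ≤ T)
    (S z : ℝ) :
    fluidValue lam α f K T t (S + z) - 2 * fluidValue lam α f K T t S +
      fluidValue lam α f K T t (S - z) ≤ 4 * K * z ^ 2 := by
  have hτ := sub_nonneg.2 htT
  obtain ⟨x, hx⟩ := hm.exists_isCostate hK hτ (S + z)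
  obtain ⟨y, hy⟩ := hm.exists_isCostate hK hτ (S - z)
  have h1 := hm.le_fluidValue_sub hK htT htT hx S
  have h2 := hm.le_fluidValue_sub hK htT htT hy S
  have h3 := hm.abs_costate_sub_le hK hτ hτ hy hx
  rw [sub_self, abs_zero, mul_zero, add_zero,
    show S + z - (S - z) = 2 * z by ring, abs_mul, abs_two] at h3
  have h4 : z * (x - y) ≤ |z| * (2 * K * (2 * |z|)) := by
    refine (le_abs_self _).trans ?_
    rw [abs_mul]
    exact mul_le_mul_of_nonneg_left h3 (abs_nonneg _)
  have h5 : |z| * (2 * K * (2 * |z|)) = 4 * K * z ^ 2 := by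
    rw [← sq_abs z]
    ring
  linarith

theorem isWeakSemiconcaveSolution_fluidValue (hm : IsSourceFamily lam α f) (hK : 0 < K) :
    IsWeakSemiconcaveSolution lam α f K T (fluidValue lam α f K T) where
  lipschitz := hm.lipschitzOnWith_fluidValue hK
  terminal := hm.fluidValue_terminal hK
  equation := by
    refine ae_of_all _ fun q hq => ?_
    obtain ⟨x, hx⟩ := hm.exists_isCostate hK (sub_nonneg.2 hq.2.le) q.2
    refine ⟨_, _, hm.hasFDerivAt_fluidValue hK hq.2 hx, ?_⟩
    rw [hm.hjOperator_eq]
    ring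
  semiconcave := by
    refine ⟨4 * K, by positivity, fun t ht S z => ?_⟩
    refine (hm.fluidValue_second_difference_le hK ht.2.le S z).trans ?_
    have h1 : 0 ≤ 1 / (T - t) := one_div_nonneg.2 (sub_nonneg.2 ht.2.le)
    have h2 : 0 ≤ 4 * K * z ^ 2 := by positivity
    nlinarith [mul_nonneg h1 h2]

end IsSourceFamily

/-! ### Lipschitz functions along lines and semi-concavity -/

/-- An almost everywhere bound on the derivative of a Lipschitz function in the direction `(1, q)`
integrates along every line of that direction. By Fubini almost every line meets the exceptional
set in a null set; the other lines are limits of these. -/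
theorem sub_le_of_ae_directional_le {w : ℝ × ℝ → ℝ} {L : ℝ≥0} {a b R q c y₀ r : ℝ} (hab : a ≤ b)
    (hr : 0 < r) (hL : LipschitzOnWith L w (Icc a b ×ˢ Icc (-R) R))
    (hin : ∀ s ∈ Icc a b, ∀ y, |y - y₀| < r → y + q * s ∈ Icc (-R) R)
    (hae : ∀ᵐ p : ℝ × ℝ, p.1 ∈ Ioo a b → |p.2 - q * p.1 - y₀| < r → ∃ vt vS : ℝ,
      HasFDerivAt w (vt • ContinuousLinearMap.fst ℝ ℝ ℝ + vS • ContinuousLinearMap.snd ℝ ℝ ℝ) p ∧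
        vt + q * vS ≤ c) :
    w (b, y₀ + q * b) - w (a, y₀ + q * a) ≤ c * (b - a) := by
  have hshear : MeasurePreserving (fun p : ℝ × ℝ => (p.1, p.2 + q * p.1)) volume volume := by
    rw [Measure.volume_eq_prod]
    refine (MeasurePreserving.id volume).skew_product (g := fun s y => y + q * s)
      (by fun_prop) (ae_of_all _ fun s => ?_)
    exact (measurePreserving_add_right volume (q * s)).map_eq
  have hswap : MeasurePreserving (Prod.swap : ℝ × ℝ → ℝ × ℝ) volume volume := by
    rw [Measure.volume_eq_prod]
    exact Measure.measurePreserving_swap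
  have hlines : ∀ᵐ y : ℝ, ∀ᵐ s : ℝ, s ∈ Ioo a b → |y - y₀| < r → ∃ vt vS : ℝ,
      HasFDerivAt w (vt • ContinuousLinearMap.fst ℝ ℝ ℝ + vS • ContinuousLinearMap.snd ℝ ℝ ℝ)
        (s, y + q * s) ∧ vt + q * vS ≤ c := by
    have h := (hshear.comp hswap).quasiMeasurePreserving.ae hae
    rw [Measure.volume_eq_prod] at h
    filter_upwards [Measure.ae_ae_of_ae_prod h] with y hy
    filter_upwards [hy] with s hs hsab hyr
    exact hs hsab (by simpa using hyr)
  have hline : ∀ᵐ y : ℝ, |y - y₀| < r → w (b, y + q * b) - w (a, y + q * a) ≤ c * (b - a) := by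
    filter_upwards [hlines] with y hy hyr
    have hlip : LipschitzWith (max 1 ‖q‖₊) (fun s : ℝ => (s, y + q * s)) := by
      refine LipschitzWith.prodMk LipschitzWith.id ?_
      refine LipschitzWith.of_dist_le_mul fun s s' => ?_
      rw [dist_add_left, Real.dist_eq, ← mul_sub, abs_mul, Real.dist_eq]
      rfl
    have hmaps : MapsTo (fun s : ℝ => (s, y + q * s)) (uIcc a b) (Icc a b ×ˢ Icc (-R) R) := by
      intro s hs
      rw [uIcc_of_le hab] at hs
      exact ⟨hs, hin s hs y hyr⟩
    have hac := (hL.comp hlip.lipschitzOnWith hmaps).absolutelyContinuousOnInterval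
    have hint := hac.integral_deriv_eq_sub
    simp only [Function.comp] at hint
    rw [← hint]
    have hmono := intervalIntegral.integral_mono_ae_restrict (g := fun _ => c) (μ := volume) hab
      hac.intervalIntegrable_deriv intervalIntegrable_const ?_
    · refine hmono.trans_eq ?_
      rw [intervalIntegral.integral_const, smul_eq_mul, mul_comm]
    · rw [← Measure.restrict_congr_set Ioo_ae_eq_Icc]
      filter_upwards [ae_restrict_mem measurableSet_Ioo, ae_restrict_of_ae hy] with s hs hys
      obtain ⟨vt, vS, hv, hle⟩ := hys hs hyr
      have hd : HasDerivAt (fun s : ℝ => (s, y + q * s)) (1, q) s := by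
        refine (hasDerivAt_id s).prodMk ?_
        simpa using ((hasDerivAt_id s).const_mul q).const_add y
      have := hv.comp_hasDerivAt s hd
      rw [this.deriv]
      simpa [mul_comm] using hle
  have htend : ∀ s ∈ Icc a b,
      Tendsto (fun y => w (s, y + q * s)) (𝓝 y₀) (𝓝 (w (s, y₀ + q * s))) := by
    intro s hs
    have hmem : (s, y₀ + q * s) ∈ Icc a b ×ˢ Icc (-R) R :=
      ⟨hs, hin s hs y₀ (by simpa using hr)⟩
    refine (hL.continuousOn _ hmem).tendsto.comp (tendsto_nhdsWithin_iff.2 ⟨?_, ?_⟩)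
    · exact Continuous.tendsto (by fun_prop) y₀
    · filter_upwards [Metric.ball_mem_nhds y₀ hr] with y hy
      exact ⟨hs, hin s hs y hy⟩
  refine le_of_tendsto_of_frequently
    ((htend b (right_mem_Icc.2 hab)).sub (htend a (left_mem_Icc.2 hab))) ?_
  have hfreq := mem_closure_iff_frequently.1 (Measure.dense_of_ae hline y₀)
  refine (hfreq.and_eventually (Metric.ball_mem_nhds y₀ hr)).mono fun y hy => ?_
  exact hy.1 hy.2

/-- A function whose second differences are at most `C z²` lies below its tangent parabolas. -/
theorem sub_le_of_second_difference_le {g : ℝ → ℝ} {C p S : ℝ} (hC : 0 ≤ C)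
    (hg : ∀ S z, g (S + z) - 2 * g S + g (S - z) ≤ C * z ^ 2) (hp : HasDerivAt g p S) (z : ℝ) :
    g (S + z) - g S ≤ p * z + C / 2 * z ^ 2 := by
  -- halving the step: the scaled remainders `2 ^ n (g (S + z / 2 ^ n) - g S - p z / 2 ^ n)`
  have hiter : ∀ n : ℕ, g (S + z) - g S - p * z ≤
      2 ^ n * (g (S + z / 2 ^ n) - g S - p * (z / 2 ^ n)) + C / 2 * z ^ 2 * (1 - 1 / 2 ^ n) := by
    intro n
    induction n with
    | zero => simp
    | succ n ih =>
      refine ih.trans ?_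
      have h := hg (S + z / 2 ^ (n + 1)) (z / 2 ^ (n + 1))
      have e1 : S + z / 2 ^ (n + 1) + z / 2 ^ (n + 1) = S + z / 2 ^ n := by
        rw [pow_succ]
        field_simp
        ring
      have e2 : S + z / 2 ^ (n + 1) - z / 2 ^ (n + 1) = S := by ring
      rw [e1, e2] at h
      have h' := mul_le_mul_of_nonneg_left h (by positivity : (0 : ℝ) ≤ 2 ^ n)
      have e3 : (2 : ℝ) ^ n * (C * (z / 2 ^ (n + 1)) ^ 2) =
          C / 2 * z ^ 2 * (1 - 1 / 2 ^ (n + 1)) - C / 2 * z ^ 2 * (1 - 1 / 2 ^ n) := by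
        rw [pow_succ]
        field_simp
        ring
      have e4 : (2 : ℝ) ^ n * (p * (z / 2 ^ n)) = p * z := by field_simp
      have e5 : (2 : ℝ) ^ (n + 1) * (p * (z / 2 ^ (n + 1))) = p * z := by field_simp
      rw [mul_sub, e4, mul_sub (2 ^ (n + 1)), e5, pow_succ 2 n]
      rw [e3, pow_succ] at h'
      rw [pow_succ] at h'
      linarith
  have hlim : Tendsto (fun n : ℕ => S + z / 2 ^ n) atTop (𝓝 S) := by
    have h0 : Tendsto (fun n : ℕ => z * (1 / 2 : ℝ) ^ n) atTop (𝓝 (z * 0)) :=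
      (tendsto_pow_atTop_nhds_zero_of_lt_one (by norm_num) (by norm_num)).const_mul z
    have h1 := h0.const_add S
    simpa [div_eq_mul_inv] using h1
  refine le_of_forall_pos_le_add fun ε hε => ?_
  have ho := Asymptotics.isLittleO_iff.1 (hasDerivAt_iff_isLittleO.1 hp)
    (show 0 < ε / (|z| + 1) by positivity)
  obtain ⟨n, hn⟩ := (hlim.eventually ho).exists
  have h2 : (0 : ℝ) < 2 ^ n := by positivity
  rw [add_sub_cancel_left, smul_eq_mul, Real.norm_eq_abs, Real.norm_eq_abs, abs_div,
    abs_of_pos h2] at hn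
  have h3 := mul_le_mul_of_nonneg_left ((le_abs_self _).trans hn) h2.le
  have h4 : 2 ^ n * (ε / (|z| + 1) * (|z| / 2 ^ n)) = ε * (|z| / (|z| + 1)) := by field_simp
  have h5 : ε * (|z| / (|z| + 1)) ≤ ε * 1 :=
    mul_le_mul_of_nonneg_left (div_le_one_of_le₀ (by linarith) (by positivity)) hε.le
  have h6 : C / 2 * z ^ 2 * (1 - 1 / 2 ^ n) ≤ C / 2 * z ^ 2 :=
    mul_le_of_le_one_right (by positivity) (sub_le_self _ (by positivity))
  have h7 := hiter n
  rw [mul_comm p (z / 2 ^ n)] at h7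
  linarith

/-! ### Uniqueness of weak semi-concave solutions -/

namespace IsSourceFamily

/-- Along the line on which the cash is spent at the constant rate `totalSpend lam α f x`, the
equation and the convexity of `H` bound the increase of a weak solution from below. -/
theorem weakSolution_le_fluidValue (hm : IsSourceFamily lam α f) (hK : 0 < K)
    (hw : IsWeakSemiconcaveSolution lam α f K T w) (ht : t ∈ Icc 0 T) (S : ℝ) :
    w t S ≤ fluidValue lam α f K T t S := by
  obtain ⟨x, hx⟩ := hm.exists_isCostate hK (sub_nonneg.2 ht.2) S
  set D := totalSpend lam α f x with hD
  have hD0 : 0 ≤ D := hm.totalSpend_nonneg x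
  set R := |S + D * t| + 1 + D * T with hR
  obtain ⟨L, hL⟩ := hw.lipschitz R
  have hL' : LipschitzOnWith L (fun p => -Function.uncurry w p) (Icc t T ×ˢ Icc (-R) R) :=
    (hL.mono (prod_mono (Icc_subset_Icc_left ht.1) le_rfl)).neg
  have key := sub_le_of_ae_directional_le (q := -D) (y₀ := S + D * t) (r := 1)
    (c := -(hamiltonian lam α f x - D * x)) ht.2 one_pos hL' ?_ ?_
  · have hT := hw.terminal (S - (T - t) * D)
    have h1 : S + D * t + -D * T = S - (T - t) * D := by ring
    have h2 : S + D * t + -D * t = S := by ring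
    simp only [Function.uncurry, h1, h2] at key
    have h3 := terminal_gap_eq_zero hK hx
    rw [hm.fluidValue_eq hK ht.2 hx, dualObjective]
    rw [hT] at key
    linarith
  · intro s hs y hy
    have hs0 : 0 ≤ s := ht.1.trans hs.1
    have h1 : D * s ≤ D * T := mul_le_mul_of_nonneg_left hs.2 hD0
    have h2 : 0 ≤ D * s := mul_nonneg hD0 hs0
    rw [abs_lt] at hy
    have h3 := neg_abs_le (S + D * t)
    have h4 := le_abs_self (S + D * t)
    constructor <;> linarith
  · filter_upwards [hw.equation] with p hp hpt _
    obtain ⟨vt, vS, hv, heq⟩ := hp ⟨ht.1.trans_lt hpt.1, hpt.2⟩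
    refine ⟨-vt, -vS, ?_, ?_⟩
    · exact hv.fun_neg.congr_fderiv (by ext <;> simp)
    · rw [hm.hjOperator_eq] at heq
      have := hm.totalSpend_mul_sub_le x vS
      linarith

/-- A weak semi-concave solution is a viscosity supersolution, with a one-sided condition in time.
At a point where a smooth function touches from below, semi-concavity forces the gradients at the
nearby points of differentiability to be close to that of the test function; the equation, which
holds at almost all of these points, then integrates along the vertical lines. -/
theorem le_hamiltonian_of_touching (hm : IsSourceFamily lam α f)
    (hw : IsWeakSemiconcaveSolution lam α f K T w) {φ : ℝ → ℝ → ℝ} {t₀ S₀ m p : ℝ}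
    (ht₀ : t₀ ∈ Ico 0 T) (hp : HasDerivAt (φ t₀) p S₀) (hφt : HasDerivAt (fun t => φ t S₀) m t₀)
    (hminS : ∀ᶠ S in 𝓝 S₀, w t₀ S₀ - φ t₀ S₀ ≤ w t₀ S - φ t₀ S)
    (hmint : ∀ᶠ t in 𝓝[>] t₀, w t₀ S₀ - φ t₀ S₀ ≤ w t S₀ - φ t S₀) :
    m ≤ hamiltonian lam α f p := by
  refine le_of_forall_pos_le_add fun ε hε => ?_
  set M := maxSpend lam f with hM
  have hM0 : 0 ≤ M := hm.maxSpend_nonneg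
  set η := ε / (3 * M + 1) with hη
  have hη0 : 0 < η := by positivity
  have hηε : M * (3 * η) + η = ε := by
    rw [hη]
    field_simp
  obtain ⟨C, hC0, hC⟩ := hw.semiconcave
  set C₁ := C * (1 + 2 / (T - t₀)) with hC₁
  have hTt : 0 < T - t₀ := sub_pos.2 ht₀.2
  have hC₁0 : 0 ≤ C₁ := by positivity
  obtain ⟨L, hL⟩ := hw.lipschitz (|S₀| + 2)
  -- the test function is below the weak solution and close to its tangent on a slice of width `ρ`
  have hslice : ∀ᶠ S in 𝓝 S₀, w t₀ S₀ + p * (S - S₀) - η * |S - S₀| ≤ w t₀ S := by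
    filter_upwards [hminS, Asymptotics.isLittleO_iff.1 (hasDerivAt_iff_isLittleO.1 hp) hη0]
      with S h1 h2
    rw [smul_eq_mul, Real.norm_eq_abs, Real.norm_eq_abs] at h2
    have h3 := (abs_le.1 h2).1
    linarith
  obtain ⟨ρ, hρ0, hρ⟩ := Metric.eventually_nhds_iff.1 hslice
  set h := min (min (ρ / 2) 1) (η / (C₁ + 1)) with hh
  have hh0 : 0 < h := by positivity
  have hhρ : h < ρ := by
    have : h ≤ ρ / 2 := (min_le_left _ _).trans (min_le_left _ _)
    linarith
  have hh1 : h ≤ 1 := (min_le_left _ _).trans (min_le_right _ _)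
  have hhC : C₁ / 2 * h ≤ η := by
    have h1 : h ≤ η / (C₁ + 1) := min_le_right _ _
    rw [le_div_iff₀ (by positivity)] at h1
    nlinarith
  set r := min (min (η * h / (2 * L + 1)) 1) ((T - t₀) / 2) with hr
  have hr0 : 0 < r := by positivity
  have hr1 : r ≤ 1 := (min_le_left _ _).trans (min_le_right _ _)
  have hrT : r ≤ (T - t₀) / 2 := min_le_right _ _
  have hrL : 2 * L * r ≤ η * h := by
    have h1 : r ≤ η * h / (2 * L + 1) := (min_le_left _ _).trans (min_le_left _ _)
    rw [le_div_iff₀ (by positivity)] at h1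
    nlinarith
  have hbox : ∀ S, |S - S₀| ≤ 2 → S ∈ Icc (-(|S₀| + 2)) (|S₀| + 2) := by
    intro S hS
    have h1 := abs_le.1 hS
    have h2 := neg_abs_le S₀
    have h3 := le_abs_self S₀
    constructor <;> linarith
  have hlip : ∀ t ∈ Icc t₀ (t₀ + r), ∀ S S', |S - S'| ≤ r → |S - S₀| ≤ 2 → |S' - S₀| ≤ 2 →
      |w t S - w t₀ S'| ≤ L * r := by
    intro t ht S S' hSS hS hS'
    have hd := hL.dist_le_mul (t, S) ⟨⟨ht₀.1.trans ht.1, by linarith [ht.2]⟩, hbox S hS⟩ (t₀, S')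
      ⟨⟨ht₀.1, ht₀.2.le⟩, hbox S' hS'⟩
    refine hd.trans (mul_le_mul_of_nonneg_left (max_le ?_ hSS) L.coe_nonneg)
    show |t - t₀| ≤ r
    rw [abs_of_nonneg (sub_nonneg.2 ht.1)]
    linarith [ht.2]
  have hgrad : ∀ t ∈ Icc t₀ (t₀ + r), ∀ S vS, |S - S₀| < r → HasDerivAt (w t) vS S →
      |vS - p| ≤ 3 * η := by
    intro t ht S vS hS hv
    have hsemi : ∀ S z, w t (S + z) - 2 * w t S + w t (S - z) ≤ C₁ * z ^ 2 := by
      intro S z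
      refine (hC t ⟨ht₀.1.trans ht.1, by linarith [ht.2]⟩ S z).trans
        (mul_le_mul_of_nonneg_right (mul_le_mul_of_nonneg_left ?_ hC0) (sq_nonneg z))
      have : 1 / (T - t) ≤ 2 / (T - t₀) := by
        rw [div_le_div_iff₀ (by linarith [ht.2]) hTt]
        linarith [ht.2]
      linarith
    have hz : ∀ z, |z| = h → (p - vS) * z ≤ 3 * η * h := by
      intro z hz
      have h1 := sub_le_of_second_difference_le hC₁0 hsemi hv z
      have h2 : w t₀ S₀ + p * z - η * |z| ≤ w t₀ (S₀ + z) := by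
        have := @hρ (S₀ + z) (by rw [Real.dist_eq, add_sub_cancel_left, hz]; exact hhρ)
        rwa [add_sub_cancel_left] at this
      have h3 := (abs_le.1 (hlip t ht S S₀ hS.le (by linarith) (by simp))).2
      have h4 := (abs_le.1 (hlip t ht (S + z) (S₀ + z) (by rw [add_sub_add_right_eq_sub]; exact hS.le)
        (by
          rw [show S + z - S₀ = (S - S₀) + z by ring]
          exact (abs_add_le _ _).trans (by linarith))
        (by rw [add_sub_cancel_left]; linarith))).1
      have h5 : C₁ / 2 * z ^ 2 ≤ η * h := by
        rw [← sq_abs, hz, sq, ← mul_assoc]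
        exact mul_le_mul_of_nonneg_right hhC hh0.le
      rw [hz] at h2
      linarith
    rw [abs_sub_comm, abs_le]
    have h1 := hz h (abs_of_pos hh0)
    have h2 := hz (-h) (by rw [abs_neg, abs_of_pos hh0])
    constructor
    · exact le_of_mul_le_mul_right (by linarith) hh0
    · exact le_of_mul_le_mul_right h1 hh0
  have hvert : ∀ t ∈ Ioo t₀ (t₀ + r),
      w t S₀ - w t₀ S₀ ≤ (hamiltonian lam α f p + M * (3 * η)) * (t - t₀) := by
    intro t ht
    have key := sub_le_of_ae_directional_le (w := Function.uncurry w) (q := 0) (y₀ := S₀) (r := r)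
      (c := hamiltonian lam α f p + M * (3 * η)) (R := |S₀| + 2) ht.1.le hr0
      (hL.mono (prod_mono (Icc_subset_Icc ht₀.1 (by linarith [ht.2])) le_rfl)) ?_ ?_
    · simpa [Function.uncurry] using key
    · intro s _ y hy
      rw [zero_mul, add_zero]
      exact hbox y (by linarith)
    · filter_upwards [hw.equation] with ⟨s, S⟩ hs hst hSr
      simp only at hst hSr
      obtain ⟨vt, vS, hv, heq⟩ := hs ⟨ht₀.1.trans_lt hst.1, by linarith [hst.2, ht.2]⟩
      refine ⟨vt, vS, hv, ?_⟩
      have hder : HasDerivAt (w s) vS S := by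
        have hd : HasDerivAt (fun S : ℝ => (s, S)) (0, 1) S :=
          (hasDerivAt_const S s).prodMk (hasDerivAt_id S)
        have := hv.comp_hasDerivAt S hd
        simpa [Function.comp_def] using this
      have h1 := hgrad s ⟨hst.1.le, by linarith [hst.2, ht.2]⟩ S vS (by simpa using hSr) hder
      have h2 := (le_abs_self _).trans (hm.abs_hamiltonian_sub_le p vS)
      have h3 := mul_le_mul_of_nonneg_left h1 hM0
      rw [hm.hjOperator_eq] at heq
      linarith
  have hlit : ∀ᶠ t in 𝓝[>] t₀, |φ t S₀ - φ t₀ S₀ - (t - t₀) * m| ≤ η * |t - t₀| :=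
    (Asymptotics.isLittleO_iff.1 (hasDerivAt_iff_isLittleO.1 hφt) hη0).filter_mono
      nhdsWithin_le_nhds
  obtain ⟨t, ⟨h1, h2⟩, ht⟩ :=
    ((hmint.and hlit).and (Ioo_mem_nhdsGT (by linarith : t₀ < t₀ + r))).exists
  have h3 := hvert t ht
  have ht0 : 0 < t - t₀ := sub_pos.2 ht.1
  rw [abs_of_pos ht0] at h2
  have h4 := (abs_le.1 h2).1
  refine le_of_mul_le_mul_right ?_ ht0
  rw [← hηε]
  linarith

/-- The affine functions `S x - (T - t) H(x) - x² / (4K)` solve the equation and lie below the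
terminal value. They stay below a weak solution: otherwise the difference, penalized by
exponentials that blow up outside the backward cone of slope `maxSpend`, would have an interior
minimum that contradicts the supersolution property. -/
theorem dualObjective_le_weakSolution (hm : IsSourceFamily lam α f) (hK : 0 < K)
    (hw : IsWeakSemiconcaveSolution lam α f K T w) {t' : ℝ} (ht' : t' ∈ Icc 0 T) (S' : ℝ)
    (hx : x ≤ 0) : dualObjective lam α f K (T - t') S' x ≤ w t' S' := by
  by_contra hlt
  set c := dualObjective lam α f K (T - t') S' x - w t' S' with hc
  have hc0 : 0 < c := sub_pos.2 (not_le.1 hlt)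
  have hterm : ∀ S, dualObjective lam α f K (T - T) S x ≤ w T S := by
    intro S
    have := terminal_gap_nonneg hK hx S
    rw [hw.terminal, dualObjective, sub_self, zero_mul]
    linarith
  have ht'T : t' < T := by
    refine lt_of_le_of_ne ht'.2 fun h => hlt ?_
    rw [h]
    exact hterm S'
  have hτ : 0 < T - t' := sub_pos.2 ht'T
  set L := maxSpend lam f with hL
  have hL0 : 0 ≤ L := hm.maxSpend_nonneg
  set R := L * (T - t') + 1 with hR
  have hR0 : 0 < R := by positivity
  set B := Icc t' T ×ˢ Icc (S' - R) (S' + R) with hB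
  set u : ℝ × ℝ → ℝ := fun q => w q.1 q.2 - dualObjective lam α f K (T - q.1) q.2 x with hu
  have hucont : ContinuousOn u B := by
    obtain ⟨Λ, hΛ⟩ := hw.lipschitz (|S'| + R)
    refine ContinuousOn.sub ?_ ?_
    · refine hΛ.continuousOn.mono (prod_mono (Icc_subset_Icc_left ht'.1) (Icc_subset_Icc ?_ ?_))
      · linarith [neg_abs_le S']
      · linarith [le_abs_self S']
    · unfold dualObjective
      fun_prop
  have hcompact : IsCompact B := isCompact_Icc.prod isCompact_Icc
  obtain ⟨A, hA⟩ := hcompact.exists_bound_of_continuousOn hucont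
  have hA0 : 0 ≤ A := (norm_nonneg _).trans
    (hA (t', S') ⟨⟨le_rfl, ht'T.le⟩, by constructor <;> linarith⟩)
  set ε := c / 4 with hε
  have hε0 : 0 < ε := by positivity
  set δ := c / (4 * (T - t')) with hδ
  have hδ0 : 0 < δ := by positivity
  have hδτ : δ * (T - t') = c / 4 := by
    rw [hδ]
    field_simp
  -- large enough for the penalty to exceed `A` on the lateral boundary
  set N := A / ε with hN
  have hN0 : 0 ≤ N := by positivity
  set P : ℝ → ℝ → ℝ := fun t S => ε * (Real.exp (N * ((S - S') - L * (t - t'))) +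
    Real.exp (N * (-(S - S') - L * (t - t')))) with hP
  have hP0 : ∀ t S, 0 ≤ P t S := fun t S => by positivity
  have hPcont : Continuous fun q : ℝ × ℝ => P q.1 q.2 := by
    simp only [hP]
    fun_prop
  obtain ⟨⟨t₀, S₀⟩, ⟨ht₀, hS₀⟩, hmin⟩ := hcompact.exists_isMinOn
    ⟨(t', S'), ⟨le_rfl, ht'T.le⟩, by constructor <;> linarith⟩
    ((hucont.add hPcont.continuousOn).add
      (show ContinuousOn (fun q : ℝ × ℝ => δ * (T - q.1)) B by fun_prop))
  simp only at ht₀ hS₀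
  have hmin : ∀ t ∈ Icc t' T, ∀ S ∈ Icc (S' - R) (S' + R),
      u (t₀, S₀) + P t₀ S₀ + δ * (T - t₀) ≤ u (t, S) + P t S + δ * (T - t) :=
    fun t ht S hS => isMinOn_iff.1 hmin (t, S) ⟨ht, hS⟩
  have hneg : u (t₀, S₀) + P t₀ S₀ + δ * (T - t₀) < 0 := by
    refine (hmin t' ⟨le_rfl, ht'T.le⟩ S' (by constructor <;> linarith)).trans_lt ?_
    have h1 : P t' S' = c / 2 := by
      simp [hP, hε]
      ring
    have h2 : u (t', S') = -c := by simp [hu, hc]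
    rw [h1, h2, hδτ]
    linarith
  have hPδ : 0 ≤ P t₀ S₀ + δ * (T - t₀) :=
    add_nonneg (hP0 _ _) (mul_nonneg hδ0.le (sub_nonneg.2 ht₀.2))
  have ht₀T : t₀ < T := by
    refine lt_of_le_of_ne ht₀.2 fun h => ?_
    have h1 : 0 ≤ u (t₀, S₀) := by
      rw [h]
      exact sub_nonneg.2 (hterm S₀)
    linarith
  have hexp : A < ε * Real.exp N := by
    have h1 := Real.add_one_le_exp N
    have h2 : ε * N = A := by
      rw [hN]
      field_simp
    nlinarith
  have hlat : ∀ σ : ℝ, σ = R → Real.exp N ≤ Real.exp (N * (σ - L * (t₀ - t'))) := by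
    rintro σ rfl
    refine Real.exp_le_exp.2 (le_mul_of_one_le_right hN0 ?_)
    have := mul_le_mul_of_nonneg_left (sub_le_sub_right ht₀.2 t') hL0
    linarith
  have hside : ¬ (S₀ - S' = R ∨ -(S₀ - S') = R) := by
    intro hside
    have h1 : ε * Real.exp N ≤ P t₀ S₀ := by
      refine mul_le_mul_of_nonneg_left ?_ hε0.le
      rcases hside with h | h
      · exact (hlat _ h).trans (le_add_of_nonneg_right (Real.exp_pos _).le)
      · exact (hlat _ h).trans (le_add_of_nonneg_left (Real.exp_pos _).le)
    have h2 := (abs_le.1 (hA (t₀, S₀) ⟨ht₀, hS₀⟩)).1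
    have h3 : 0 ≤ δ * (T - t₀) := mul_nonneg hδ0.le (sub_nonneg.2 ht₀.2)
    linarith
  have hS₀' : S₀ ∈ Ioo (S' - R) (S' + R) := by
    refine ⟨lt_of_le_of_ne hS₀.1 fun h => hside (Or.inr ?_),
      lt_of_le_of_ne hS₀.2 fun h => hside (Or.inl ?_)⟩ <;> linarith
  set e₁ := ε * (Real.exp (N * ((S₀ - S') - L * (t₀ - t'))) * N) with he₁
  set e₂ := ε * (Real.exp (N * (-(S₀ - S') - L * (t₀ - t'))) * N) with he₂
  have he₁0 : 0 ≤ e₁ := by positivity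
  have he₂0 : 0 ≤ e₂ := by positivity
  have hPS : HasDerivAt (P t₀) (e₁ - e₂) S₀ := by
    have h1 : HasDerivAt (fun S => N * ((S - S') - L * (t₀ - t'))) N S₀ := by
      simpa using ((((hasDerivAt_id S₀).sub_const S').sub_const (L * (t₀ - t'))).const_mul N)
    have h2 : HasDerivAt (fun S => N * (-(S - S') - L * (t₀ - t'))) (-N) S₀ := by
      simpa using ((((hasDerivAt_id S₀).sub_const S').neg.sub_const (L * (t₀ - t'))).const_mul N)
    exact ((h1.exp.add h2.exp).const_mul ε).congr_deriv (by rw [he₁, he₂]; ring)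
  have hPt : HasDerivAt (fun t => P t S₀) (-(L * (e₁ + e₂))) t₀ := by
    have h0 : ∀ σ : ℝ, HasDerivAt (fun t => N * (σ - L * (t - t'))) (-(N * L)) t₀ := fun σ => by
      simpa using ((((hasDerivAt_id t₀).sub_const t').const_mul L).const_sub σ).const_mul N
    exact (((h0 _).exp.add (h0 _).exp).const_mul ε).congr_deriv (by rw [he₁, he₂]; ring)
  set φ : ℝ → ℝ → ℝ := fun t S =>
    dualObjective lam α f K (T - t) S x - P t S - δ * (T - t) with hφ
  have hφS : HasDerivAt (φ t₀) (x - (e₁ - e₂)) S₀ := by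
    have h1 : HasDerivAt (fun S => dualObjective lam α f K (T - t₀) S x) x S₀ := by
      unfold dualObjective
      simpa using (((hasDerivAt_id S₀).mul_const x).sub_const
        ((T - t₀) * hamiltonian lam α f x)).sub_const (x ^ 2 / (4 * K))
    exact (h1.sub hPS).sub_const _
  have hφt : HasDerivAt (fun t => φ t S₀) (hamiltonian lam α f x + L * (e₁ + e₂) + δ) t₀ := by
    have h0 : HasDerivAt (fun t => T - t) (-1) t₀ := (hasDerivAt_id t₀).const_sub T
    have h1 : HasDerivAt (fun t => dualObjective lam α f K (T - t) S₀ x)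
        (hamiltonian lam α f x) t₀ := by
      unfold dualObjective
      simpa using ((h0.mul_const (hamiltonian lam α f x)).const_sub (S₀ * x)).sub_const
        (x ^ 2 / (4 * K))
    exact ((h1.sub hPt).sub (h0.const_mul δ)).congr_deriv (by ring)
  have hwφ : ∀ t S, w t S - φ t S = u (t, S) + P t S + δ * (T - t) := fun t S => by
    simp only [hu, hφ]
    ring
  have key := hm.le_hamiltonian_of_touching hw ⟨ht'.1.trans ht₀.1, ht₀T⟩ hφS hφt ?_ ?_
  · have h1 := (le_abs_self _).trans (hm.abs_hamiltonian_sub_le x (x - (e₁ - e₂)))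
    have h2 : |x - (e₁ - e₂) - x| ≤ e₁ + e₂ := abs_le.2 ⟨by linarith, by linarith⟩
    have h3 := mul_le_mul_of_nonneg_left h2 hL0
    linarith
  · filter_upwards [Icc_mem_nhds hS₀'.1 hS₀'.2] with S hS
    rw [hwφ, hwφ]
    exact hmin t₀ ht₀ S hS
  · filter_upwards [Ioo_mem_nhdsGT ht₀T] with t ht
    rw [hwφ, hwφ]
    exact hmin t ⟨ht₀.1.trans ht.1.le, ht.2.le⟩ S₀ hS₀

theorem weakSolution_eq_fluidValue (hm : IsSourceFamily lam α f) (hK : 0 < K)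
    (hw : IsWeakSemiconcaveSolution lam α f K T w) (ht : t ∈ Icc 0 T) (S : ℝ) :
    w t S = fluidValue lam α f K T t S := by
  refine le_antisymm (hm.weakSolution_le_fluidValue hK hw ht S) ?_
  refine (hm.isLUB_fluidValue hK ht.2 S).2 ?_
  rintro _ ⟨x, hx, rfl⟩
  exact hm.dualObjective_le_weakSolution hK hw ht S hx

end IsSourceFamily

/-! ### The optimal feedback -/

/-- A primitive that vanishes at `t` stays nonpositive if its density is nonpositive wherever the
primitive is positive. -/
theorem integral_nonpos_of_dissipative {h : ℝ → ℝ} (hh : IntervalIntegrable h volume t T)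
    (hdiss : ∀ᵐ r ∂(volume.restrict (Icc t T)), 0 < ∫ s in t..r, h s → h r ≤ 0) {s : ℝ}
    (hs : s ∈ Icc t T) : ∫ r in t..s, h r ≤ 0 := by
  by_contra! hpos
  have hint : ∀ a ∈ Icc t T, ∀ c ∈ Icc t T, IntervalIntegrable h volume a c := fun a ha c hc =>
    hh.mono_set (by
      rw [uIcc_of_le (hs.1.trans hs.2)]
      exact uIcc_subset_Icc ha hc)
  have htT := hs.1.trans hs.2
  have htI : t ∈ Icc t T := left_mem_Icc.2 htT
  have hcont : ContinuousOn (fun r => ∫ s in t..r, h s) (Icc t s) := by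
    refine (intervalIntegral.continuousOn_primitive_interval ?_).mono
      (Icc_subset_Icc_right hs.2 |>.trans (uIcc_of_le htT).symm.subset)
    rw [uIcc_of_le htT]
    exact (intervalIntegrable_iff_integrableOn_Icc_of_le htT).1 hh
  -- the last time at which the primitive is nonpositive
  obtain ⟨r₀, ⟨hr₀, hr₀'⟩, hlast⟩ :=
    ((isCompact_Icc.of_isClosed_subset (hcont.preimage_isClosed_of_isClosed isClosed_Icc
      (isClosed_Iic (a := (0 : ℝ)))) inter_subset_left).exists_isGreatest
      ⟨t, left_mem_Icc.2 hs.1, by simp⟩)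
  have hr₀T : r₀ ∈ Icc t T := ⟨hr₀.1, hr₀.2.trans hs.2⟩
  have hsplit := intervalIntegral.integral_add_adjacent_intervals (hint t htI r₀ hr₀T)
    (hint r₀ hr₀T s hs)
  have hle : ∫ r in r₀..s, h r ≤ 0 := by
    have hmono := intervalIntegral.integral_mono_ae_restrict (g := fun _ => 0) (μ := volume) hr₀.2
      (hint r₀ hr₀T s hs) intervalIntegrable_const ?_
    · simpa using hmono
    · rw [← Measure.restrict_congr_set Ioc_ae_eq_Icc]
      filter_upwards [ae_restrict_mem measurableSet_Ioc, ae_restrict_of_ae_restrict_of_subset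
        (show Ioc r₀ s ⊆ Icc t T from fun r hr => ⟨hr₀.1.trans hr.1.le, hr.2.trans hs.2⟩) hdiss]
        with r hr hdr
      refine hdr (not_le.1 fun hr0 => ?_)
      exact absurd (hlast ⟨⟨hr₀.1.trans hr.1.le, hr.2⟩, hr0⟩) (not_le.2 hr.1)
  have : ∫ r in t..r₀, h r ≤ 0 := hr₀'
  linarith

theorem fluidCash_congr {b' : Fin J → ℝ → ℝ≥0∞}
    (h : ∀ j, ∀ᵐ s ∂(volume.restrict (Icc t T)), b j s = b' j s) {s : ℝ} (hs : s ∈ Icc t T) :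
    fluidCash lam f t S b s = fluidCash lam f t S b' s := by
  have hall := ae_all_iff.2 h
  rw [fluidCash, fluidCash, intervalIntegral.integral_of_le hs.1,
    intervalIntegral.integral_of_le hs.1]
  congr 1
  refine integral_congr_ae ?_
  filter_upwards [ae_restrict_of_ae_restrict_of_subset
    (show Ioc t s ⊆ Icc t T from fun r hr => ⟨hr.1.le, hr.2.trans hs.2⟩) hall] with r hr
  simp only [hr]

theorem fluidCost_congr {b' : Fin J → ℝ → ℝ≥0∞} (htT : t ≤ T)
    (h : ∀ j, ∀ᵐ s ∂(volume.restrict (Icc t T)), b j s = b' j s) :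
    fluidCost lam α f K T t S b = fluidCost lam α f K T t S b' := by
  rw [fluidCost, fluidCost, fluidCash_congr h (right_mem_Icc.2 htT)]
  congr 2
  refine Finset.sum_congr rfl fun j _ => ?_
  rw [intervalIntegral.integral_of_le htT, intervalIntegral.integral_of_le htT]
  congr 1
  refine integral_congr_ae ?_
  filter_upwards [ae_restrict_of_ae_restrict_of_subset Ioc_subset_Icc_self (h j)] with r hr
  rw [hr]

theorem sum_mul_meanPrice_eq (lam : Fin J → ℝ) (f : Fin J → ℝ → ℝ) (τ : ℝ) :
    ∑ j, lam j * τ * meanPrice (f j) = τ * maxSpend lam f := by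
  rw [maxSpend, Finset.mul_sum]
  exact Finset.sum_congr rfl fun j _ => by ring

theorem totalSpend_zero (lam : Fin J → ℝ) (f : Fin J → ℝ → ℝ) (hα : ∀ j, 0 < α j) :
    totalSpend lam α f 0 = maxSpend lam f :=
  Finset.sum_congr rfl fun j _ => by rw [sourceSpend_eq_meanPrice (f j) (hα j) le_rfl]

/-- Spending at the rate of the costate keeps the costate constant. -/
theorem IsCostate.transport (hx : IsCostate lam α f K (T - t) S x) (s : ℝ) :
    IsCostate lam α f K (T - s) (S - (s - t) * totalSpend lam α f x) x := by
  refine ⟨hx.nonpos, ?_, fun h => ?_⟩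
  · have := hx.slope_le
    linarith
  · have := hx.slope_eq h
    linarith

namespace IsSourceFamily

theorem isCostate_of_deriv (hm : IsSourceFamily lam α f) (hx : x < 0)
    (hS : S = τ * deriv (hamiltonian lam α f) x + x / (2 * K)) :
    IsCostate lam α f K τ S x := by
  rw [(hm.hasDerivAt_hamiltonian (Or.inl hx.ne)).deriv] at hS
  exact ⟨hx.le, hS.ge, fun _ => hS⟩

theorem costate_unique (hm : IsSourceFamily lam α f) (hK : 0 < K) (hτ : 0 ≤ τ)
    (hx : IsCostate lam α f K τ S x) (hy : IsCostate lam α f K τ S y) : y = x := by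
  have := hm.abs_costate_sub_le hK hτ hτ hx hy
  simp only [sub_self, abs_zero, mul_zero, add_zero] at this
  exact sub_eq_zero.1 (abs_nonpos_iff.1 this)

theorem strictMono_slope (hm : IsSourceFamily lam α f) (hK : 0 < K) (hτ : 0 ≤ τ) :
    StrictMono fun x => τ * totalSpend lam α f x + x / (2 * K) := fun _ _ hxy =>
  add_lt_add_of_le_of_lt (mul_le_mul_of_nonneg_left (hm.totalSpend_mono hxy.le) hτ)
    (div_lt_div_of_pos_right hxy (by positivity))

theorem costate_mono (hm : IsSourceFamily lam α f) (hK : 0 < K) (hτ : 0 ≤ τ) {S' : ℝ}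
    (hS : S ≤ S') (hx : IsCostate lam α f K τ S x) (hy : IsCostate lam α f K τ S' y) : x ≤ y := by
  by_contra! h
  have h1 := hm.strictMono_slope hK hτ h
  have h2 := hy.slope_eq (h.trans_le hx.nonpos)
  have h3 := hx.slope_le
  simp only at h1
  linarith

theorem costate_neg (hα : ∀ j, 0 < α j) (hS : S < τ * maxSpend lam f)
    (hx : IsCostate lam α f K τ S x) : x < 0 := by
  refine lt_of_le_of_ne hx.nonpos fun h => ?_
  have := hx.slope_le
  rw [h, totalSpend_zero lam f hα] at this
  simp only [zero_div, add_zero] at this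
  linarith

theorem exists_unique_solution (hm : IsSourceFamily lam α f) (hα : ∀ j, 0 < α j) (hK : 0 < K)
    (hτ : 0 ≤ τ) (hS : S < τ * maxSpend lam f) :
    ∃ x : ℝ, x < 0 ∧ S = τ * deriv (hamiltonian lam α f) x + x / (2 * K) ∧
      ∀ y : ℝ, S = τ * deriv (hamiltonian lam α f) y + y / (2 * K) → y = x := by
  obtain ⟨x, hx⟩ := hm.exists_isCostate hK hτ S
  have hx0 := costate_neg hα hS hx
  have hd : ∀ y, deriv (hamiltonian lam α f) y = totalSpend lam α f y := fun y =>
    (hm.hasDerivAt_hamiltonian (Or.inr hα)).deriv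
  refine ⟨x, hx0, by rw [hd]; exact hx.slope_eq hx0, fun y hy => ?_⟩
  rw [hd] at hy
  exact (hm.strictMono_slope hK hτ).injective (hy.symm.trans (hx.slope_eq hx0))

/-- A closed-loop control has no choice: the spending rate prescribed by the feedback is
nondecreasing in the cash, so two closed-loop trajectories that start at the same point cannot
separate. -/
theorem eq_optimalBid_of_followsFeedback (hm : IsSourceFamily lam α f) (hK : 0 < K)
    (htT : t ≤ T) (hx : IsCostate lam α f K (T - t) S x) {β : Fin J → ℝ → ℝ → ℝ≥0∞}
    (hβ : ∀ s ∈ Icc t T, ∀ S' z, IsCostate lam α f K (T - s) S' z →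
      ∀ j, β j s S' = optimalBid (α j) z)
    (hb : IsControl t T b) (hfb : FollowsFeedback lam f T t S β b) (j : Fin J) :
    ∀ᵐ s ∂(volume.restrict (Icc t T)), b j s = optimalBid (α j) x := by
  set D := totalSpend lam α f x with hD
  set g : ℝ → ℝ := fun s => ∑ j, lam j * priceSpend (f j) (b j s) with hg
  have hgint : IntervalIntegrable g volume t T := by
    have h := IntervalIntegrable.sum Finset.univ fun j _ =>
      (hb.intervalIntegrable_priceSpend htT j (hm.density j)).const_mul (lam j)
    refine h.congr fun s _ => ?_
    simp [hg]
  have hcash : ∀ s ∈ Icc t T,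
      fluidCash lam f t S b s = S - (s - t) * D + ∫ r in t..s, (D - g r) := by
    intro s hs
    rw [intervalIntegral.integral_sub intervalIntegrable_const
      (hgint.mono_set (uIcc_subset_uIcc_left (by rwa [uIcc_of_le htT]))),
      intervalIntegral.integral_const, fluidCash, smul_eq_mul]
    ring
  have hfb' := ae_all_iff.2 hfb
  have hrate : ∀ᵐ r ∂(volume.restrict (Icc t T)),
      (0 < ∫ s in t..r, (D - g s) → D - g r ≤ 0) ∧
      (∫ s in t..r, (D - g s) < 0 → 0 ≤ D - g r) := by
    filter_upwards [hfb', ae_restrict_mem measurableSet_Icc] with r hr hrI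
    have hτ : 0 ≤ T - r := sub_nonneg.2 hrI.2
    obtain ⟨z, hz⟩ := hm.exists_isCostate hK hτ (fluidCash lam f t S b r)
    have hgz : g r = totalSpend lam α f z := by
      rw [← hm.sum_priceSpend_optimalBid hz.nonpos]
      refine Finset.sum_congr rfl fun j _ => ?_
      rw [hr j, hβ r hrI _ z hz]
    have hc := hcash r hrI
    rw [hgz]
    constructor <;> intro h <;> rw [hD]
    · have := hm.totalSpend_mono (hm.costate_mono hK hτ (by linarith) (hx.transport r) hz)
      linarith
    · have := hm.totalSpend_mono (hm.costate_mono hK hτ (by linarith) hz (hx.transport r))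
      linarith
  have hDg : IntervalIntegrable (fun r => D - g r) volume t T := intervalIntegrable_const.sub hgint
  have hzero : ∀ s ∈ Icc t T, ∫ r in t..s, (D - g r) = 0 := by
    intro s hs
    refine le_antisymm (integral_nonpos_of_dissipative hDg (hrate.mono fun r hr => hr.1) hs) ?_
    have h := integral_nonpos_of_dissipative hDg.neg (hrate.mono fun r hr => ?_) hs
    · simp only [Pi.neg_apply, intervalIntegral.integral_neg] at h
      linarith
    · simp only [Pi.neg_apply, intervalIntegral.integral_neg]
      intro h0
      have := hr.2 (by linarith)
      linarith
  filter_upwards [hfb j, ae_restrict_mem measurableSet_Icc] with s hs hsI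
  rw [hs, hcash s hsI, hzero s hsI, add_zero, hβ s hsI _ x (hx.transport s)]

theorem isOptimalFeedback (hm : IsSourceFamily lam α f) (hα : ∀ j, 0 < α j) (hK : 0 < K)
    {β : Fin J → ℝ → ℝ → ℝ≥0∞}
    (hβ : ∀ t ∈ Icc 0 T, ∀ S x, IsCostate lam α f K (T - t) S x →
      ∀ j, β j t S = optimalBid (α j) x) :
    IsOptimalFeedback lam α f K T β := by
  intro t ht S
  obtain ⟨x, hx⟩ := hm.exists_isCostate hK (sub_nonneg.2 ht.2) S
  have hβ' : ∀ s ∈ Icc t T, ∀ S' z, IsCostate lam α f K (T - s) S' z →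
      ∀ j, β j s S' = optimalBid (α j) z := fun s hs => hβ s ⟨ht.1.trans hs.1, hs.2⟩
  have hfollow : ∀ b : Fin J → ℝ → ℝ≥0∞,
      (∀ j, ∀ᵐ s ∂(volume.restrict (Icc t T)), b j s = optimalBid (α j) x) →
      FollowsFeedback lam f T t S β b := by
    intro b hb j
    filter_upwards [hb j, ae_restrict_mem measurableSet_Icc] with s hs hsI
    rw [hs, fluidCash_congr hb hsI, hm.fluidCash_optimalBid hx.nonpos,
      hβ' s hsI _ x (hx.transport s)]
  refine ⟨⟨fun j _ => optimalBid (α j) x, isControl_const _,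
    hfollow _ fun j => ae_of_all _ fun _ => rfl⟩, fun b hb => ⟨fun hopt => ?_, fun hfb => ?_⟩⟩
  · exact hfollow b fun j => hm.eq_optimalBid_of_isOptimalControl hα hK ht.2 hx hopt j
  · refine ⟨hb, fun b' hb' => ?_⟩
    rw [fluidCost_congr ht.2
      fun j => hm.eq_optimalBid_of_followsFeedback hK ht.2 hx hβ' hb hfb j]
    exact (hm.isOptimalControl_optimalBid hK ht.2 hx).2 b' hb'

theorem feedback_eq_optimalBid (hm : IsSourceFamily lam α f) (hα : ∀ j, 0 < α j) (hK : 0 < K)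
    {β : Fin J → ℝ → ℝ → ℝ≥0∞} (hτ : 0 ≤ τ)
    (htop : τ * maxSpend lam f ≤ S → ∀ j, β j t S = ⊤)
    (hfin : S < τ * maxSpend lam f → ∀ x : ℝ,
      S = τ * deriv (hamiltonian lam α f) x + x / (2 * K) →
        ∀ j, β j t S = ENNReal.ofReal (-α j / x))
    (hx : IsCostate lam α f K τ S x) (j : Fin J) : β j t S = optimalBid (α j) x := by
  rcases le_or_gt (τ * maxSpend lam f) S with h | h
  · have h0 : IsCostate lam α f K τ S 0 := by
      refine ⟨le_rfl, ?_, fun h => absurd h (lt_irrefl _)⟩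
      rw [totalSpend_zero lam f hα]
      simpa using h
    rw [htop h j, hm.costate_unique hK hτ h0 hx]
    simp [optimalBid, (hα j).ne']
  · have hx0 := costate_neg hα h hx
    rw [optimalBid, if_pos hx0]
    refine hfin h x ?_ j
    rw [(hm.hasDerivAt_hamiltonian (Or.inr hα)).deriv]
    exact hx.slope_eq hx0

end IsSourceFamily

end

theorem theorem2 {J : ℕ} (hJ : 1 ≤ J) (lam α : Fin J → ℝ) (f : Fin J → ℝ → ℝ) (K T : ℝ)
    (hlam : ∀ j, 0 < lam j) (hα : ∀ j, 0 ≤ α j) (hf : ∀ j, IsPriceDensity (f j))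
    (hK : 0 < K) (hT : 0 < T) :
    -- the formula for the value function
    (∀ t ∈ Icc 0 T, ∀ S : ℝ,
      IsLUB ((fun x : ℝ => S * x - (T - t) * hamiltonian lam α f x - x ^ 2 / (4 * K)) '' Iic 0)
        (fluidValue lam α f K T t S)) ∧
    -- the value function is the unique weak semi-concave solution
    IsWeakSemiconcaveSolution lam α f K T (fluidValue lam α f K T) ∧
    (∀ w : ℝ → ℝ → ℝ, IsWeakSemiconcaveSolution lam α f K T w →
      ∀ t ∈ Icc 0 T, ∀ S : ℝ, w t S = fluidValue lam α f K T t S) ∧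
    -- infinite bids are optimal when the cash is large
    (∀ t ∈ Icc 0 T, ∀ S : ℝ, (∑ j, lam j * (T - t) * meanPrice (f j)) ≤ S →
      IsOptimalControl lam α f K T t S (fun _ _ => ⊤)) ∧
    -- a negative solution of the characteristic equation yields optimal bids
    (∀ t ∈ Icc 0 T, ∀ S : ℝ, ∀ x < 0,
      S = (T - t) * deriv (hamiltonian lam α f) x + x / (2 * K) →
        IsOptimalControl lam α f K T t S (fun j _ => ENNReal.ofReal (-α j / x))) ∧
    -- the optimal control function, for positive weights
    ((∀ j, 0 < α j) →
      Differentiable ℝ (hamiltonian lam α f) ∧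
      (∀ t ∈ Icc 0 T, ∀ S : ℝ, S < (∑ j, lam j * (T - t) * meanPrice (f j)) →
        ∃ x : ℝ, x < 0 ∧ S = (T - t) * deriv (hamiltonian lam α f) x + x / (2 * K) ∧
          ∀ y : ℝ, S = (T - t) * deriv (hamiltonian lam α f) y + y / (2 * K) → y = x) ∧
      ∀ β : Fin J → ℝ → ℝ → ℝ≥0∞,
        (∀ t ∈ Icc 0 T, ∀ S : ℝ, (∑ j, lam j * (T - t) * meanPrice (f j)) ≤ S →
          ∀ j, β j t S = ⊤) →
        (∀ t ∈ Icc 0 T, ∀ S : ℝ, S < (∑ j, lam j * (T - t) * meanPrice (f j)) →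
          ∀ x : ℝ, S = (T - t) * deriv (hamiltonian lam α f) x + x / (2 * K) →
            ∀ j, β j t S = ENNReal.ofReal (-α j / x)) →
        IsOptimalFeedback lam α f K T β) := by
  have hm : IsSourceFamily lam α f := ⟨hlam, hα, hf⟩
  simp only [sum_mul_meanPrice_eq]
  refine ⟨fun t ht S => hm.isLUB_fluidValue hK ht.2 S, hm.isWeakSemiconcaveSolution_fluidValue hK,
    fun w hw t ht S => hm.weakSolution_eq_fluidValue hK hw ht S,
    fun t ht S hS => hm.isOptimalControl_top hK ht.2 hS, fun t ht S x hx hS => ?_,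
    fun hα' => ⟨fun x => (hm.hasDerivAt_hamiltonian (Or.inr hα')).differentiableAt,
      fun t ht S hS => hm.exists_unique_solution hα' hK (sub_nonneg.2 ht.2) hS,
      fun β htop hfin => hm.isOptimalFeedback hα' hK fun t ht S x hx j => ?_⟩⟩
  · have h := hm.isOptimalControl_optimalBid hK ht.2 (hm.isCostate_of_deriv hx hS)
    simpa only [optimalBid, if_pos hx] using h
  · exact hm.feedback_eq_optimalBid hα' hK (sub_nonneg.2 ht.2) (htop t ht S) (hfin t ht S) hx j
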